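/- Fix $n\ge 2$ and let $F_n$ be the Brown–Thompson group, i.e. the group of fractions $s/t$ of planar rooted $n$-ary trees $s,t$ with the same number of leaves, where $s/t=s'/t'$ if and only if there are $n$-ary forests $p,q$ with $ps=qs'$ and $pt=qt'$, with product determined by $(r/s)(s/t)=r/t$. An $(a,b)$-strand diagram is (the isotopy class of) a finite acyclic directed graph embedded in the unit square with $a$ univalent sources on the top side and $b$ univalent sinks on the bottom side, all of whose other vertices are splits (one incoming and $n$ outgoing edges) or merges ($n$ incoming edges and one outgoing edge). A reduction replaces a split and a merge joined by $n$ parallel edges by a single edge (type I), or a merge whose outgoing edge enters a split by $n$ parallel edges (type II); a diagram is reduced if no reduction is possible, and two diagrams are equivalent if they are joined by a sequence of reductions and inverse reductions. Products of diagrams are concatenations, the left factor being on top, and $S^{-1}$ is the reflection of $S$ about a horizontal line. A $(1,1)$-strand diagram represents $s/t\in F_n$ if it is equivalent to the diagram consisting of $s$ (root at the top) placed on the reflection of $t$. Let $g\in F_n$. Call $(m,S,E_g)$ an essential decomposition of $g$ if $S$ is a $(1,m)$-strand diagram and $E_g$ is an $(m,m)$-strand diagram such that $S E_g S^{-1}$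 represents $g$ and every concatenation $E_g^p$, $p\geq 0$, is a reduced diagram (in particular $E_g$ and $E_gE_g$ are reduced). Then $g$ has an essential decomposition. Moreover, for every essential decomposition $(m,S,E_g)$ of $g$ and all $h,\tilde h\in F_n$ there exist $k,m'\in\mathbb N$, a $(1,m')$-strand diagram $S_+$, an $(m',1)$-strand diagram $S_-$ and a reduced $(m',m')$-strand diagram $\tilde E_g$, equal to $E_g$ up to parallel edges, such that for all $p\ge k$ the concatenated diagram $$S_+\,\tilde E_g^{\,p-k+1}\,S_-$$ is reduced and represents $h g^p\tilde h$. Here "equal up to parallel edges" is the equivalence relation generated by replacing an edge which joins the $i$-th source to the $i$-th sink, for some $i$, by $n$ parallel such edges. When $h=\tilde h=1$, such an $\tilde E_g$ is called the essential part of $g$. -/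

import Mathlib

namespace BrownThompson

/-! ## Planar `n`-ary trees and forests -/

/-- Planar rooted `n`-ary trees: every vertex which is not a leaf has `n` ordered children. -/
inductive NTree (n : ℕ) : Type
  | leaf : NTree n
  | node (children : Fin n → NTree n) : NTree n

namespace NTree

variable {n : ℕ}

/-- The number of leaves of a tree (the target of the tree as a morphism `1 → k` of forests). -/
def leaves : NTree n → ℕ
  | leaf => 1
  | node c => ∑ j, (c j).leaves

/-- The composition `p t` of a tree `t : 1 → k` with a forest `p` having `k` roots, obtained by
stacking `p` on `t`: the `i`-th leaf of `t` (counted from the left, starting at `0`) is replaced by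
the `i`-th tree `p i` of the forest.  The values `p i` with `k ≤ i` are not used. -/
def graft : NTree n → (ℕ → NTree n) → NTree n
  | leaf, p => p 0
  | node c, p => node fun j => (c j).graft fun i => p ((∑ l ∈ Finset.Iio j, (c l).leaves) + i)

/-- Composition of forests: `q` is stacked on `p`. -/
def stack (p q : ℕ → NTree n) : ℕ → NTree n :=
  fun i => (p i).graft fun x => q ((∑ l ∈ Finset.range i, (p l).leaves) + x)

/-- Prefix sums of a finite sequence, with a natural number as bound. -/
def pre (w : Fin n → ℕ) (j : ℕ) : ℕ :=
  ∑ l ∈ Finset.range j, if h : l < n then w ⟨l, h⟩ else 0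

theorem sum_Iio_eq_pre (w : Fin n → ℕ) (j : Fin n) : ∑ l ∈ Finset.Iio j, w l = pre w j := by
  unfold pre
  refine Finset.sum_bij (fun l _ => (l : ℕ)) ?_ ?_ ?_ ?_
  · intro a ha
    simpa using ha
  · intro a _ b _ hab
    exact Fin.ext hab
  · intro b hb
    have hb' : b < j := by simpa using hb
    exact ⟨⟨b, hb'.trans j.2⟩, by simpa [Fin.lt_def] using hb', rfl⟩
  · intro a _
    simp

theorem sum_univ_eq_pre (w : Fin n → ℕ) : ∑ l, w l = pre w n := by
  unfold pre
  rw [← Fin.sum_univ_eq_sum_range (fun l => if h : l < n then w ⟨l, h⟩ else 0) n]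
  simp

theorem pre_succ (w : Fin n → ℕ) (j : Fin n) : pre w (j + 1) = pre w j + w j := by
  unfold pre
  rw [Finset.sum_range_succ]
  simp

theorem sum_pre (w : Fin n → ℕ) (x : ℕ → ℕ) (j : ℕ) (hj : j ≤ n) :
    ∑ i ∈ Finset.range (pre w j), x i
      = pre (fun l : Fin n => ∑ i ∈ Finset.range (w l), x (pre w l + i)) j := by
  induction j with
  | zero => simp [pre]
  | succ j ih =>
    have h := pre_succ w ⟨j, hj⟩
    have h2 := pre_succ (fun l : Fin n => ∑ i ∈ Finset.range (w l), x (pre w l + i)) ⟨j, hj⟩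
    simp only at h h2
    rw [h, h2, Finset.sum_range_add, ih (by omega)]

theorem exists_pre (w : Fin n → ℕ) (i : ℕ) (j : ℕ) (hj : j ≤ n) (hi : i < pre w j) :
    ∃ (l : Fin n) (y : ℕ), y < w l ∧ i = pre w l + y := by
  induction j with
  | zero => simp [pre] at hi
  | succ j ih =>
    have h := pre_succ w ⟨j, hj⟩
    simp only at h
    by_cases hlt : i < pre w j
    · exact ih (by omega) hlt
    · exact ⟨⟨j, hj⟩, i - pre w j, by omega, by simp only; omega⟩

theorem exists_glue {α : Type*} (w : Fin n → ℕ) (f : Fin n → ℕ → α) (a : α) (j : ℕ) (hj : j ≤ n) :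
    ∃ p : ℕ → α, ∀ l : Fin n, (l : ℕ) < j → ∀ i < w l, p (pre w l + i) = f l i := by
  induction j with
  | zero => exact ⟨fun _ => a, by simp⟩
  | succ j ih =>
    obtain ⟨p, hp⟩ := ih (by omega)
    refine ⟨fun x => if x < pre w j then p x else f ⟨j, hj⟩ (x - pre w j), ?_⟩
    intro l hl i hi
    by_cases hlj : (l : ℕ) < j
    · have hmono : pre w (l + 1) ≤ pre w j :=
        Finset.sum_le_sum_of_subset (Finset.range_mono hlj)
      have := pre_succ w l
      simp only
      rw [if_pos (by omega)]
      exact hp l hlj i hi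
    · have : l = ⟨j, hj⟩ := Fin.ext (by simp only; omega)
      subst this
      simp

theorem graft_node (c : Fin n → NTree n) (p : ℕ → NTree n) :
    (node c).graft p
      = node fun j => (c j).graft fun i => p (pre (fun l => (c l).leaves) j + i) := by
  simp only [graft, sum_Iio_eq_pre (fun l => (c l).leaves)]

theorem leaves_node (c : Fin n → NTree n) : (node c).leaves = pre (fun l => (c l).leaves) n := by
  simp only [leaves, sum_univ_eq_pre (fun l => (c l).leaves)]

theorem graft_eq_iff (t : NTree n) (p q : ℕ → NTree n) :
    t.graft p = t.graft q ↔ ∀ i < t.leaves, p i = q i := by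
  induction t generalizing p q with
  | leaf => simp [graft, leaves]
  | node c ih =>
    rw [graft_node, graft_node, leaves_node]
    constructor
    · intro h i hi
      obtain ⟨l, y, hy, rfl⟩ := exists_pre _ i n le_rfl hi
      injection h with h
      exact (ih l _ _).1 (congrFun h l) y hy
    · intro h
      congr 1
      funext l
      refine (ih l _ _).2 fun i hi => h _ ?_
      have hmono : pre (fun l => (c l).leaves) (l + 1) ≤ pre (fun l => (c l).leaves) n :=
        Finset.sum_le_sum_of_subset (Finset.range_mono l.2)
      have := pre_succ (fun l => (c l).leaves) l
      omega

theorem leaves_graft (t : NTree n) (p : ℕ → NTree n) :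
    (t.graft p).leaves = ∑ i ∈ Finset.range t.leaves, (p i).leaves := by
  induction t generalizing p with
  | leaf => simp [graft, leaves]
  | node c ih =>
    rw [graft_node, leaves_node, leaves_node, sum_pre _ _ _ le_rfl]
    simp only [ih]

theorem graft_graft (t : NTree n) (p q : ℕ → NTree n) :
    (t.graft p).graft q = t.graft (stack p q) := by
  induction t generalizing p q with
  | leaf => simp [graft, stack]
  | node c ih =>
    rw [graft_node, graft_node, graft_node]
    congr 1
    funext j
    rw [ih]
    congr 1
    funext i
    unfold stack
    congr 1
    funext x
    simp only [leaves_graft]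
    rw [Finset.sum_range_add, add_assoc,
      sum_pre (fun l => (c l).leaves) (fun i => (p i).leaves) j j.2.le]

theorem graft_leaf (t : NTree n) : t.graft (fun _ => leaf) = t := by
  induction t with
  | leaf => rfl
  | node c ih => rw [graft_node]; simp only [ih]

theorem exists_common (s t : NTree n) : ∃ p q, s.graft p = t.graft q := by
  induction s generalizing t with
  | leaf => exact ⟨fun _ => t, fun _ => leaf, by rw [graft_leaf]; rfl⟩
  | node c ih =>
    cases t with
    | leaf => exact ⟨fun _ => leaf, fun _ => node c, by rw [graft_leaf]; rfl⟩
    | node d =>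
      choose p q hpq using fun j => ih j (d j)
      obtain ⟨P, hP⟩ := exists_glue (fun l => (c l).leaves) p leaf n le_rfl
      obtain ⟨Q, hQ⟩ := exists_glue (fun l => (d l).leaves) q leaf n le_rfl
      refine ⟨P, Q, ?_⟩
      rw [graft_node, graft_node]
      congr 1
      funext j
      rw [(graft_eq_iff (c j) _ (p j)).2 (hP j j.2), (graft_eq_iff (d j) _ (q j)).2 (hQ j j.2)]
      exact hpq j

end NTree

/-! ## The Brown–Thompson group `F_n` -/

/-- A pair of trees `(s, t)` with the same number of leaves, written as a fraction `s / t`. -/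
structure TreePair (n : ℕ) where
  num : NTree n
  den : NTree n
  same : num.leaves = den.leaves

namespace TreePair

variable {n : ℕ}

/-- The fraction `p s / p t`. -/
def expand (x : TreePair n) (p : ℕ → NTree n) : TreePair n where
  num := x.num.graft p
  den := x.den.graft p
  same := by rw [NTree.leaves_graft, NTree.leaves_graft, x.same]

/-- `s / t` and `s' / t'` are identified if there are forests `p, q` such that
`p s = q s'` and `p t = q t'`. -/
def Rel (x y : TreePair n) : Prop :=
  ∃ p q : ℕ → NTree n, x.num.graft p = y.num.graft q ∧ x.den.graft p = y.den.graft q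

theorem Rel.refl (x : TreePair n) : Rel x x := ⟨fun _ => .leaf, fun _ => .leaf, rfl, rfl⟩

theorem Rel.symm {x y : TreePair n} : Rel x y → Rel y x := by
  rintro ⟨p, q, h1, h2⟩
  exact ⟨q, p, h1.symm, h2.symm⟩

theorem Rel.trans {x y z : TreePair n} : Rel x y → Rel y z → Rel x z := by
  rintro ⟨p, q, h1, h2⟩ ⟨p', q', h3, h4⟩
  obtain ⟨u, v, huv⟩ := NTree.exists_common (y.num.graft q) (y.num.graft p')
  have hden : (y.den.graft q).graft u = (y.den.graft p').graft v := by
    rw [NTree.graft_graft, NTree.graft_graft, NTree.graft_eq_iff] at huv ⊢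
    rwa [← y.same]
  refine ⟨NTree.stack p u, NTree.stack q' v, ?_, ?_⟩
  · rw [← NTree.graft_graft, ← NTree.graft_graft, h1, huv, h3]
  · rw [← NTree.graft_graft, ← NTree.graft_graft, h2, hden, h4]

instance setoid (n : ℕ) : Setoid (TreePair n) where
  r := Rel
  iseqv := ⟨Rel.refl, Rel.symm, Rel.trans⟩

theorem rel_expand (x : TreePair n) (p : ℕ → NTree n) : Rel x (x.expand p) :=
  ⟨p, fun _ => .leaf, by rw [NTree.graft_leaf]; rfl, by rw [NTree.graft_leaf]; rfl⟩

/-- If `x = r / s` and `y = s / t`, this is `r / t`. -/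
def glue (x y : TreePair n) (h : x.den = y.num) : TreePair n where
  num := x.num
  den := y.den
  same := by rw [x.same, h, y.same]

theorem glue_rel {x y x' y' : TreePair n} (h : x.den = y.num) (h' : x'.den = y'.num)
    (hx : Rel x x') (hy : Rel y y') : Rel (glue x y h) (glue x' y' h') := by
  obtain ⟨p, q, h1, h2⟩ := hx
  obtain ⟨p', q', h3, h4⟩ := hy
  obtain ⟨u, v, huv⟩ := NTree.exists_common (x.den.graft p) (x.den.graft p')
  have e1 : (y.den.graft p).graft u = (y.den.graft p').graft v := by
    rw [NTree.graft_graft, NTree.graft_graft, NTree.graft_eq_iff] at huv ⊢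
    rwa [← y.same, ← h]
  have e2 : (x'.den.graft q).graft u = (x'.den.graft q').graft v := by
    rw [← h2, huv, h, h3, h']
  have e3 : (y'.den.graft q).graft u = (y'.den.graft q').graft v := by
    rw [NTree.graft_graft, NTree.graft_graft, NTree.graft_eq_iff] at e2 ⊢
    rwa [← y'.same, ← h']
  refine ⟨NTree.stack p u, NTree.stack q u, ?_, ?_⟩
  · simp only [glue]
    rw [← NTree.graft_graft, ← NTree.graft_graft, h1]
  · simp only [glue]
    rw [← NTree.graft_graft, ← NTree.graft_graft, e1, e3, h4]

/-- The product of `r / s` and `s' / t`: both fractions are first expanded so that the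
denominator of the first is the numerator of the second. -/
noncomputable def mul (x y : TreePair n) : TreePair n :=
  glue (x.expand (NTree.exists_common x.den y.num).choose)
    (y.expand (NTree.exists_common x.den y.num).choose_spec.choose)
    (NTree.exists_common x.den y.num).choose_spec.choose_spec

theorem mul_rel {x y x' y' : TreePair n} (hx : Rel x x') (hy : Rel y y') :
    Rel (mul x y) (mul x' y') :=
  glue_rel _ _ (((rel_expand _ _).symm.trans hx).trans (rel_expand _ _))
    (((rel_expand _ _).symm.trans hy).trans (rel_expand _ _))

theorem mul_rel_glue (x y : TreePair n) (h : x.den = y.num) : Rel (mul x y) (glue x y h) :=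
  glue_rel _ _ (rel_expand _ _).symm (rel_expand _ _).symm

/-- The inverse fraction. -/
def swap (x : TreePair n) : TreePair n := ⟨x.den, x.num, x.same.symm⟩

end TreePair

/-- The Brown–Thompson group `F_n`: fractions `s / t` of `n`-ary trees with the same number of
leaves, with the product determined by `(r / s) (s / t) = r / t`. -/
def ThompsonF (n : ℕ) : Type := Quotient (TreePair.setoid n)

namespace ThompsonF

variable {n : ℕ}

/-- The element `s / t` of `F_n`. -/
def mk (x : TreePair n) : ThompsonF n := Quotient.mk (TreePair.setoid n) x

theorem mk_eq_mk {x y : TreePair n} : mk x = mk y ↔ TreePair.Rel x y :=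
  Quotient.eq (r := TreePair.setoid n)

theorem exists_rep (a : ThompsonF n) : ∃ x, mk x = a := Quotient.exists_rep a

noncomputable instance : Mul (ThompsonF n) :=
  ⟨Quotient.map₂ TreePair.mul fun _ _ hx _ _ hy => TreePair.mul_rel hx hy⟩

instance : One (ThompsonF n) := ⟨mk ⟨.leaf, .leaf, rfl⟩⟩

instance : Inv (ThompsonF n) :=
  ⟨Quotient.map TreePair.swap fun _ _ ⟨p, q, h1, h2⟩ => ⟨p, q, h2, h1⟩⟩

/-- The group law `(r / s) (s / t) = r / t`. -/
theorem mk_mul_mk (x y : TreePair n) (h : x.den = y.num) :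
    mk x * mk y = mk (TreePair.glue x y h) :=
  mk_eq_mk.2 (TreePair.mul_rel_glue x y h)

theorem mk_expand (x : TreePair n) (p : ℕ → NTree n) : mk (x.expand p) = mk x :=
  mk_eq_mk.2 (TreePair.rel_expand x p).symm

theorem exists_rep₂ (a b : ThompsonF n) :
    ∃ x y : TreePair n, mk x = a ∧ mk y = b ∧ x.den = y.num := by
  obtain ⟨x, rfl⟩ := exists_rep a
  obtain ⟨y, rfl⟩ := exists_rep b
  obtain ⟨p, q, h⟩ := NTree.exists_common x.den y.num
  exact ⟨x.expand p, y.expand q, mk_expand _ _, mk_expand _ _, h⟩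

theorem mk_self (t : NTree n) : mk ⟨t, t, rfl⟩ = 1 :=
  mk_eq_mk.2 ⟨fun _ => .leaf, fun _ => t, by rw [NTree.graft_leaf]; rfl,
    by rw [NTree.graft_leaf]; rfl⟩

noncomputable instance : Group (ThompsonF n) :=
  Group.ofLeftAxioms
    (by
      intro a b c
      obtain ⟨x, rfl⟩ := exists_rep a
      obtain ⟨y, z, rfl, rfl, hyz⟩ := exists_rep₂ b c
      obtain ⟨p, q, h⟩ := NTree.exists_common x.den y.num
      have hyz' : (y.expand q).den = (z.expand q).num := by simp [TreePair.expand, hyz]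
      rw [← mk_expand x p, ← mk_expand y q, ← mk_expand z q, mk_mul_mk _ _ h,
        mk_mul_mk _ _ hyz']
      exact (mk_mul_mk (TreePair.glue (x.expand p) (y.expand q) h) (z.expand q) hyz').trans
        (mk_mul_mk (x.expand p) (TreePair.glue (y.expand q) (z.expand q) hyz') h).symm)
    (by
      intro a
      obtain ⟨x, rfl⟩ := exists_rep a
      rw [← mk_self x.num, mk_mul_mk _ _ rfl]
      rfl)
    (by
      intro a
      obtain ⟨x, rfl⟩ := exists_rep a
      change mk x.swap * mk x = 1
      rw [mk_mul_mk _ _ rfl, ← mk_self x.den]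
      rfl)

end ThompsonF

/-! ## Strand diagrams -/

/-- The two kinds of interior vertices of a strand diagram: a split has one incoming and `n`
outgoing edges, a merge has `n` incoming edges and one outgoing edge. -/
inductive VertexKind : Type
  | split
  | merge

namespace VertexKind

/-- The number of incoming edges. -/
def inputs (n : ℕ) : VertexKind → ℕ
  | split => 1
  | merge => n

/-- The number of outgoing edges. -/
def outputs (n : ℕ) : VertexKind → ℕ
  | split => n
  | merge => 1

/-- The kind of a vertex after reflection about a horizontal line. -/
def flip : VertexKind → VertexKind
  | split => merge
  | merge => split

end VertexKind

/-- A horizontal layer of a strand diagram, containing exactly one vertex; `left` is the number of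
strands that pass to the left of the vertex. -/
structure Layer : Type where
  kind : VertexKind
  left : ℕ

/-- `IsLayering n h l k`: the layers of the list `l`, read from top to bottom, fit together to a
diagram with `h` strands at the top and `k` strands at the bottom. In each layer, `a` strands pass
to the left and `b` strands pass to the right of the vertex. -/
inductive IsLayering (n : ℕ) : ℕ → List Layer → ℕ → Prop
  | nil (h : ℕ) : IsLayering n h [] h
  | cons (v : VertexKind) (a b : ℕ) {l : List Layer} {k : ℕ}
      (hl : IsLayering n (a + v.outputs n + b) l k) :
      IsLayering n (a + v.inputs n + b) (⟨v, a⟩ :: l) k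

/-- An `(h, k)`-strand diagram (with `n`-ary splits and merges), drawn in the unit square with `h`
sources on the top side and `k` sinks on the bottom side, all edges running monotonically downwards
and the vertices at distinct heights. Every finite acyclic directed graph embedded in the square,
with all its sources on the top, all its sinks on the bottom and only splits and merges in the
interior, has such a drawing; two drawings of the same embedded graph are related by `Isotopic`. -/
structure StrandDiagram (n h k : ℕ) : Type where
  layers : List Layer
  isLayering : IsLayering n h layers k

theorem IsLayering.append {n h k m : ℕ} {l l' : List Layer} (H : IsLayering n h l k)
    (H' : IsLayering n k l' m) : IsLayering n h (l ++ l') m := by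
  induction H with
  | nil => exact H'
  | cons v a b _ ih => exact .cons v a b (ih H')

theorem IsLayering.reflect {n h k : ℕ} {l : List Layer} (H : IsLayering n h l k) :
    IsLayering n k (l.map fun x => ⟨x.kind.flip, x.left⟩).reverse h := by
  induction H with
  | nil => exact .nil _
  | cons v a b _ ih =>
    rw [List.map_cons, List.reverse_cons]
    refine ih.append ?_
    cases v
    · exact .cons .merge a b (.nil _)
    · exact .cons .split a b (.nil _)

theorem IsLayering.addRight {n h k : ℕ} {l : List Layer} (H : IsLayering n h l k) (c : ℕ) :
    IsLayering n (h + c) l (k + c) := by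
  induction H with
  | nil => exact .nil _
  | cons v a b _ ih =>
    rw [add_assoc]
    refine .cons v a (b + c) ?_
    rwa [add_assoc] at ih

theorem IsLayering.addLeft {n h k : ℕ} {l : List Layer} (H : IsLayering n h l k) (c : ℕ) :
    IsLayering n (c + h) (l.map fun x => ⟨x.kind, c + x.left⟩) (c + k) := by
  induction H with
  | nil => exact .nil _
  | cons v a b _ ih =>
    rw [← add_assoc, ← add_assoc]
    refine .cons v (c + a) b ?_
    rwa [← add_assoc, ← add_assoc] at ih

namespace StrandDiagram

variable {n : ℕ}

/-- The diagram consisting of `m` parallel edges. -/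
def strands (n m : ℕ) : StrandDiagram n m m := ⟨[], .nil m⟩

/-- Concatenation: `A` is placed on top of `B`. -/
def comp {h k m : ℕ} (A : StrandDiagram n h k) (B : StrandDiagram n k m) : StrandDiagram n h m :=
  ⟨A.layers ++ B.layers, A.isLayering.append B.isLayering⟩

/-- Reflection about a horizontal line. -/
def reflect {h k : ℕ} (A : StrandDiagram n h k) : StrandDiagram n k h :=
  ⟨(A.layers.map fun x => ⟨x.kind.flip, x.left⟩).reverse, A.isLayering.reflect⟩

/-- Juxtaposition: `A` is placed to the left of `B`. -/
def beside {h k h' k' : ℕ} (A : StrandDiagram n h k) (B : StrandDiagram n h' k') :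
    StrandDiagram n (h + h') (k + k') :=
  ⟨A.layers ++ B.layers.map fun x => ⟨x.kind, k + x.left⟩,
    (A.isLayering.addRight h').append (B.isLayering.addLeft k)⟩

/-- The concatenation of `p` copies of an `(m, m)`-strand diagram. -/
def power {m : ℕ} (E : StrandDiagram n m m) : ℕ → StrandDiagram n m m
  | 0 => strands n m
  | p + 1 => (E.power p).comp E

/-- `D'` arises from `D` by exchanging the heights of two vertically consecutive vertices which are
not joined by an edge: a vertex of kind `v` on the left and a vertex of kind `w` on the right,
with `c` strands passing between them. -/
def Exchange {h k : ℕ} (D D' : StrandDiagram n h k) : Prop :=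
  ∃ (P Q : List Layer) (v w : VertexKind) (a c : ℕ),
    D.layers = P ++ [⟨v, a⟩, ⟨w, a + v.outputs n + c⟩] ++ Q ∧
    D'.layers = P ++ [⟨w, a + v.inputs n + c⟩, ⟨v, a⟩] ++ Q

/-- `D` and `D'` are drawings of the same embedded graph, up to isotopy. -/
def Isotopic {h k : ℕ} : StrandDiagram n h k → StrandDiagram n h k → Prop :=
  Relation.EqvGen Exchange

/-- `D'` arises from `D` by cancelling two vertically consecutive vertices. Either a split whose `n`
outgoing edges are, in order, the incoming edges of a merge is replaced, together with this merge,
by a single edge (type I), or a merge whose outgoing edge is the incoming edge of a split is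
replaced, together with this split, by `n` parallel edges (type II). -/
def Cancel {h k : ℕ} (D D' : StrandDiagram n h k) : Prop :=
  ∃ (P Q : List Layer) (v : VertexKind) (a : ℕ),
    D.layers = P ++ [⟨v, a⟩, ⟨v.flip, a⟩] ++ Q ∧ D'.layers = P ++ Q

/-- A reduction of strand diagrams, that is, a move of type I or II. The two vertices involved
can always be drawn consecutively. -/
def Reduction {h k : ℕ} (D D' : StrandDiagram n h k) : Prop :=
  ∃ C C' : StrandDiagram n h k, Isotopic D C ∧ Cancel C C' ∧ Isotopic C' D'

/-- A strand diagram is reduced if no reduction is possible. -/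
def IsReduced {h k : ℕ} (D : StrandDiagram n h k) : Prop :=
  ∀ D' : StrandDiagram n h k, ¬ Reduction D D'

/-- Two strand diagrams are equivalent if one is obtained from the other by a sequence of
reductions and inverse reductions (and isotopies). -/
def Equivalent {h k : ℕ} : StrandDiagram n h k → StrandDiagram n h k → Prop :=
  Relation.EqvGen fun D D' => Isotopic D D' ∨ Reduction D D'

/-- Equality of two diagrams up to parallel edges: the relation generated by isotopy and the
operation of replacing an edge that joins the `i`-th source with the `i`-th sink by `n` parallel
edges of the same kind. (Such an edge divides the diagram into a part `A` on its left and a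
part `B` on its right.) -/
inductive EqUpToParallelEdges : ∀ {m m' : ℕ}, StrandDiagram n m m → StrandDiagram n m' m' → Prop
  | isotopic {m : ℕ} {D D' : StrandDiagram n m m} (hD : Isotopic D D') : EqUpToParallelEdges D D'
  | replace {a b : ℕ} (A : StrandDiagram n a a) (B : StrandDiagram n b b) :
      EqUpToParallelEdges ((A.beside (strands n 1)).beside B) ((A.beside (strands n n)).beside B)
  | symm {m m' : ℕ} {D : StrandDiagram n m m} {D' : StrandDiagram n m' m'}
      (hD : EqUpToParallelEdges D D') : EqUpToParallelEdges D' D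
  | trans {m m' m'' : ℕ} {D : StrandDiagram n m m} {D' : StrandDiagram n m' m'}
      {D'' : StrandDiagram n m'' m''} (hD : EqUpToParallelEdges D D')
      (hD' : EqUpToParallelEdges D' D'') : EqUpToParallelEdges D D''

end StrandDiagram

/-! ## Strand diagrams of elements of `F_n` -/

/-- The layers of a tree whose root edge is the strand with `a` strands on its left; the root
is at the top and all the vertices are splits. -/
def NTree.layers {n : ℕ} : NTree n → ℕ → List Layer
  | .leaf, _ => []
  | .node c, a => ⟨.split, a⟩ :: (List.finRange n).reverse.flatMap fun j => (c j).layers (a + j)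

theorem isLayering_flatMap {n : ℕ} (m : ℕ) (f : Fin m → ℕ → List Layer) (w : Fin m → ℕ)
    (hf : ∀ j a b, IsLayering n (a + 1 + b) (f j a) (a + w j + b)) (a b : ℕ) :
    IsLayering n (a + m + b) ((List.finRange m).reverse.flatMap fun j => f j (a + j))
      (a + (∑ j, w j) + b) := by
  induction m generalizing a b with
  | zero => simpa using IsLayering.nil (n := n) (a + b)
  | succ m ih =>
    rw [List.finRange_succ, List.reverse_cons, List.flatMap_append, Fin.sum_univ_succ]
    have h1 := ih (fun j => f j.succ) (fun j => w j.succ) (fun j => hf j.succ) (a + 1) b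
    have h2 := hf 0 a ((∑ j : Fin m, w j.succ) + b)
    rw [show a + (m + 1) + b = a + 1 + m + b by omega,
      show a + (w 0 + ∑ j : Fin m, w j.succ) + b = a + w 0 + ((∑ j : Fin m, w j.succ) + b) by omega]
    refine IsLayering.append (k := a + 1 + (∑ j : Fin m, w j.succ) + b) ?_ ?_
    · rw [← List.map_reverse, List.flatMap_map]
      simpa only [Fin.val_succ, add_assoc, add_comm, add_left_comm] using h1
    · simpa only [List.flatMap_cons, List.flatMap_nil, List.append_nil, Fin.val_zero, add_zero,
        add_assoc] using h2

theorem NTree.isLayering {n : ℕ} (t : NTree n) (a b : ℕ) :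
    IsLayering n (a + 1 + b) (t.layers a) (a + t.leaves + b) := by
  induction t generalizing a b with
  | leaf => exact .nil _
  | node c ih =>
    exact .cons .split a b (isLayering_flatMap n (fun j => (c j).layers) (fun j => (c j).leaves)
      ih a b)

/-- The `(1, k)`-strand diagram of a tree with `k` leaves. -/
def NTree.diagram {n : ℕ} (t : NTree n) : StrandDiagram n 1 t.leaves :=
  ⟨t.layers 0, by simpa using t.isLayering 0 0⟩

/-- The `(1, 1)`-strand diagram of a fraction `s / t`: the tree `s` on top of the reflected
tree `t`, leaves attached to leaves. -/
def TreePair.diagram {n : ℕ} (x : TreePair n) : StrandDiagram n 1 1 :=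
  x.num.diagram.comp ⟨x.den.diagram.reflect.layers, by
    rw [x.same]; exact x.den.diagram.reflect.isLayering⟩

/-- The `(1, 1)`-strand diagram `D` represents the element `g` of `F_n`. -/
def StrandDiagram.Represents {n : ℕ} (D : StrandDiagram n 1 1) (g : ThompsonF n) : Prop :=
  ∃ x : TreePair n, ThompsonF.mk x = g ∧ D.Equivalent x.diagram

/-- A decomposition `g = S E S⁻¹` with a `(1, m)`-strand diagram `S` and a reduced
`(m, m)`-strand diagram `E` such that no reduction is possible when copies of `E` are
concatenated. -/
def IsEssentialDecomposition {n m : ℕ} (g : ThompsonF n) (S : StrandDiagram n 1 m)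
    (E : StrandDiagram n m m) : Prop :=
  ((S.comp E).comp S.reflect).Represents g ∧ ∀ p : ℕ, (E.power p).IsReduced

end BrownThompson

open BrownThompson

namespace BrownThompson

/-! ## Labellings of strands -/

/-! Diagrams are studied through labels pushed from top to bottom. With formal terms as labels, the
bottom labels determine a drawing up to isotopy (`liso_of_run_eq`) and show every possible
cancellation (`isReduced_iff_noRedex`). With labels in the algebra `NormalTerm`, where split and
merge are mutually inverse, reductions do not change the induced map `act`. On reduced diagrams the
two labellings agree, so reduced forms are unique: `act` is a complete invariant of equivalence
(`equivalent_iff`), and being reduced means having the fewest vertices in the class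
(`isReduced_iff_le`).

For existence, write `g = S E S⁻¹` with `E` as small as possible. If a vertex of a power of `E`
cancelled across copies, it could be drawn at the top of `E`; rotating it to the bottom gives
another minimal conjugate, and induction on the exponent, over all minimal conjugates at once, gives
a contradiction (`noRedex_listPower_of_minimal`).

For the second claim, the amount by which the reduced form of `A E^q` falls short of full length is
bounded, so after absorbing a power of `E` into `A` nothing cancels on that side
(`exists_stable_right`); reflection handles the other side. A cancellation still left in `A E^q B`
with `q` large joins `A` to `B` along strands crossing many copies of `E`. By planarity such strands
do not drift, so they are parallel edges from the `i`-th source to the `i`-th sink. Cancelling the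
pair replaces `n` of these edges by one or one by `n`, and shortens `A`; hence the process stops
(`exists_reduced_sandwich`). -/

theorem VertexKind.flip_flip (v : VertexKind) : v.flip.flip = v := by cases v <;> rfl

theorem VertexKind.inputs_flip (n : ℕ) (v : VertexKind) : v.flip.inputs n = v.outputs n := by
  cases v <;> rfl

theorem VertexKind.outputs_flip (n : ℕ) (v : VertexKind) : v.flip.outputs n = v.inputs n := by
  cases v <;> rfl

theorem VertexKind.inputs_pos {n : ℕ} (hn : 0 < n) (v : VertexKind) : 0 < v.inputs n := by
  cases v
  · exact Nat.one_pos
  · exact hn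

theorem VertexKind.outputs_pos {n : ℕ} (hn : 0 < n) (v : VertexKind) : 0 < v.outputs n := by
  cases v
  · exact hn
  · exact Nat.one_pos

/-- Operations with which the strands of a diagram can be labelled from top to bottom. -/
class StrandAlgebra (n : ℕ) (α : Type) where
  /-- The label of the `j`-th outgoing edge of a split. -/
  sp : ℕ → α → α
  /-- The label of the outgoing edge of a merge. -/
  mg : (Fin n → α) → α

section Labels

variable {n : ℕ} {α β : Type} [StrandAlgebra n α] [StrandAlgebra n β]

/-- The label of the `j`-th outgoing edge of a vertex with incoming edges labelled by `g`. -/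
def outLabel (n : ℕ) {α : Type} [StrandAlgebra n α] : VertexKind → ℕ → (ℕ → α) → α
  | .split, j, g => StrandAlgebra.sp n j (g 0)
  | .merge, _, g => StrandAlgebra.mg fun j : Fin n => g j

theorem outLabel_congr (v : VertexKind) (j : ℕ) {g g' : ℕ → α}
    (h : ∀ i < v.inputs n, g i = g' i) : outLabel n v j g = outLabel n v j g' := by
  cases v
  · simp only [outLabel]
    rw [h 0 Nat.one_pos]
  · simp only [outLabel]
    congr 1
    funext i
    exact h i i.2

/-- The labels below a layer, in terms of the labels above it. There are infinitely many strands;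
those outside the diagram are not touched. -/
def step (n : ℕ) {α : Type} [StrandAlgebra n α] (u : Layer) (f : ℕ → α) : ℕ → α := fun i =>
  if i < u.left then f i
  else if i < u.left + u.kind.outputs n then
    outLabel n u.kind (i - u.left) fun j => f (u.left + j)
  else f (i + u.kind.inputs n - u.kind.outputs n)

theorem step_left (v : VertexKind) {a i : ℕ} (f : ℕ → α) (h : i < a) :
    step n ⟨v, a⟩ f i = f i := by
  simp [step, h]

theorem step_out (v : VertexKind) (a : ℕ) {j : ℕ} (f : ℕ → α) (h : j < v.outputs n) :
    step n ⟨v, a⟩ f (a + j) = outLabel n v j fun j => f (a + j) := by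
  simp [step, h]

theorem step_right (v : VertexKind) (a c : ℕ) (f : ℕ → α) :
    step n ⟨v, a⟩ f (a + v.outputs n + c) = f (a + v.inputs n + c) := by
  unfold step
  rw [if_neg (by simp only; omega), if_neg (by simp only; omega)]
  congr 1
  simp only
  omega

theorem layer_cases (v : VertexKind) (a i : ℕ) :
    i < a ∨ (∃ j < v.outputs n, i = a + j) ∨ ∃ c, i = a + v.outputs n + c := by
  by_cases h : i < a
  · exact .inl h
  by_cases h' : i < a + v.outputs n
  · exact .inr (.inl ⟨i - a, by omega, by omega⟩)
  · exact .inr (.inr ⟨i - a - v.outputs n, by omega⟩)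

/-- The two vertices read and write disjoint blocks of strands. This is what makes every labelling
an isotopy invariant (`LIso.run_eq`). -/
theorem step_exchange (v w : VertexKind) (a c : ℕ) (f : ℕ → α) :
    step n ⟨w, a + v.outputs n + c⟩ (step n ⟨v, a⟩ f)
      = step n ⟨v, a⟩ (step n ⟨w, a + v.inputs n + c⟩ f) := by
  funext i
  rcases layer_cases (n := n) v a i with h | ⟨j, hj, rfl⟩ | ⟨d, rfl⟩
  · rw [step_left _ _ (by omega), step_left _ _ h, step_left _ _ h, step_left _ _ (by omega)]
  · rw [step_left _ _ (by omega), step_out _ _ _ hj, step_out _ _ _ hj]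
    refine outLabel_congr v j fun i hi => ?_
    rw [step_left _ _ (by omega)]
  · rw [step_right]
    rcases layer_cases (n := n) w c d with h | ⟨j, hj, rfl⟩ | ⟨e, rfl⟩
    · rw [step_left _ _ (by omega), step_right, step_left _ _ (by omega)]
    · rw [← add_assoc, ← add_assoc, step_out _ _ _ hj, step_out _ _ _ hj]
      refine outLabel_congr w j fun i _ => ?_
      rw [add_assoc, step_right, add_assoc (a + v.inputs n)]
    · rw [← add_assoc, ← add_assoc, ← add_assoc, ← add_assoc, step_right, step_right, add_assoc,
        add_assoc, step_right]
      congr 1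
      omega

/-- The labels at the bottom of a list of layers, in terms of those at the top. -/
def run (n : ℕ) {α : Type} [StrandAlgebra n α] (l : List Layer) (f : ℕ → α) : ℕ → α :=
  l.foldl (fun g u => step n u g) f

@[simp] theorem run_nil (f : ℕ → α) : run n [] f = f := rfl

@[simp] theorem run_cons (u : Layer) (l : List Layer) (f : ℕ → α) :
    run n (u :: l) f = run n l (step n u f) := rfl

@[simp] theorem run_append (l l' : List Layer) (f : ℕ → α) :
    run n (l ++ l') f = run n l' (run n l f) := List.foldl_append

/-- A map which commutes with the operations. -/
def IsStrandHom (n : ℕ) {α β : Type} [StrandAlgebra n α] [StrandAlgebra n β] (φ : α → β) : Prop :=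
  (∀ j x, φ (StrandAlgebra.sp n j x) = StrandAlgebra.sp n j (φ x)) ∧
    ∀ c : Fin n → α, φ (StrandAlgebra.mg c) = StrandAlgebra.mg (φ ∘ c)

theorem IsStrandHom.outLabel {φ : α → β} (hφ : IsStrandHom n φ) (v : VertexKind) (j : ℕ)
    (g : ℕ → α) : φ (outLabel n v j g) = outLabel n v j (φ ∘ g) := by
  cases v
  · exact hφ.1 _ _
  · exact hφ.2 _

theorem IsStrandHom.step {φ : α → β} (hφ : IsStrandHom n φ) (u : Layer) (f : ℕ → α) :
    φ ∘ step n u f = step n u (φ ∘ f) := by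
  funext i
  simp only [BrownThompson.step, Function.comp_apply]
  split_ifs
  · rfl
  · exact hφ.outLabel _ _ _
  · rfl

theorem IsStrandHom.run {φ : α → β} (hφ : IsStrandHom n φ) (l : List Layer) (f : ℕ → α) :
    φ ∘ run n l f = run n l (φ ∘ f) := by
  induction l generalizing f with
  | nil => rfl
  | cons u l ih => rw [run_cons, run_cons, ih, hφ.step]

end Labels

/-! ## Isotopy of lists of layers -/

/-- The exchange of the heights of two consecutive vertices, for lists of layers. -/
def LExchange (n : ℕ) (l l' : List Layer) : Prop :=
  ∃ (P Q : List Layer) (v w : VertexKind) (a c : ℕ),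
    l = P ++ [⟨v, a⟩, ⟨w, a + v.outputs n + c⟩] ++ Q ∧
    l' = P ++ [⟨w, a + v.inputs n + c⟩, ⟨v, a⟩] ++ Q

/-- Isotopy of lists of layers. -/
def LIso (n : ℕ) : List Layer → List Layer → Prop := Relation.EqvGen (LExchange n)

namespace LIso

variable {n : ℕ} {l l' l'' : List Layer}

theorem refl (l : List Layer) : LIso n l l := Relation.EqvGen.refl l

theorem of_eq (h : l = l') : LIso n l l' := h ▸ refl l

theorem symm (h : LIso n l l') : LIso n l' l := Relation.EqvGen.symm _ _ h

theorem trans (h : LIso n l l') (h' : LIso n l' l'') : LIso n l l'' :=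
  Relation.EqvGen.trans _ _ _ h h'

theorem swap (n : ℕ) (v w : VertexKind) (a c : ℕ) :
    LIso n [⟨v, a⟩, ⟨w, a + v.outputs n + c⟩] [⟨w, a + v.inputs n + c⟩, ⟨v, a⟩] :=
  Relation.EqvGen.rel _ _ ⟨[], [], v, w, a, c, by simp, by simp⟩

theorem context (h : LIso n l l') (x y : List Layer) : LIso n (x ++ l ++ y) (x ++ l' ++ y) := by
  induction h with
  | rel l l' h =>
    obtain ⟨P, Q, v, w, a, c, rfl, rfl⟩ := h
    exact Relation.EqvGen.rel _ _ ⟨x ++ P, Q ++ y, v, w, a, c, by simp, by simp⟩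
  | refl => exact refl _
  | symm _ _ _ ih => exact ih.symm
  | trans _ _ _ _ _ ih ih' => exact ih.trans ih'

theorem append_left (x : List Layer) (h : LIso n l l') : LIso n (x ++ l) (x ++ l') := by
  simpa using h.context x []

theorem append_right (h : LIso n l l') (y : List Layer) : LIso n (l ++ y) (l' ++ y) := by
  simpa using h.context [] y

theorem append {m m' : List Layer} (h : LIso n l l') (h' : LIso n m m') :
    LIso n (l ++ m) (l' ++ m') :=
  (h.append_right m).trans (h'.append_left l')

theorem length_eq (h : LIso n l l') : l.length = l'.length := by
  induction h with
  | rel l l' h =>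
    obtain ⟨P, Q, v, w, a, c, rfl, rfl⟩ := h
    simp
  | refl => rfl
  | symm _ _ _ ih => exact ih.symm
  | trans _ _ _ _ _ ih ih' => exact ih.trans ih'

theorem run_eq {α : Type} [StrandAlgebra n α] (h : LIso n l l') :
    run n (α := α) l = run n l' := by
  induction h with
  | rel l l' h =>
    obtain ⟨P, Q, v, w, a, c, rfl, rfl⟩ := h
    funext f
    simp only [run_append, run_cons, run_nil, step_exchange]
  | refl => rfl
  | symm _ _ _ ih => exact ih.symm
  | trans _ _ _ _ _ ih ih' => exact ih.trans ih'

end LIso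

/-! ### Strand counts, and isotopy of lists versus isotopy of diagrams. -/

theorem isLayering_nil_iff {n h k : ℕ} : IsLayering n h [] k ↔ h = k := by
  constructor
  · rintro ⟨⟩
    rfl
  · rintro rfl
    exact .nil _

theorem isLayering_cons_iff {n h k : ℕ} {v : VertexKind} {a : ℕ} {l : List Layer} :
    IsLayering n h (⟨v, a⟩ :: l) k ↔
      ∃ b, h = a + v.inputs n + b ∧ IsLayering n (a + v.outputs n + b) l k := by
  constructor
  · rintro ⟨⟩
    exact ⟨_, rfl, by assumption⟩
  · rintro ⟨b, rfl, h⟩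
    exact .cons _ _ _ h

theorem isLayering_append_iff {n h k : ℕ} {l l' : List Layer} :
    IsLayering n h (l ++ l') k ↔ ∃ m, IsLayering n h l m ∧ IsLayering n m l' k := by
  constructor
  · intro H
    induction l generalizing h with
    | nil => exact ⟨h, .nil _, H⟩
    | cons u l ih =>
      obtain ⟨b, rfl, H'⟩ := isLayering_cons_iff.1 H
      obtain ⟨m, h1, h2⟩ := ih H'
      exact ⟨m, .cons _ _ _ h1, h2⟩
  · rintro ⟨m, h1, h2⟩
    exact h1.append h2

theorem LExchange.isLayering_iff {n h k : ℕ} {l l' : List Layer} (H : LExchange n l l') :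
    IsLayering n h l k ↔ IsLayering n h l' k := by
  obtain ⟨P, Q, v, w, a, c, rfl, rfl⟩ := H
  simp only [isLayering_append_iff, isLayering_cons_iff, isLayering_nil_iff]
  constructor
  · rintro ⟨m, ⟨p, hP, b, rfl, b', hb', rfl⟩, hQ⟩
    obtain rfl : b = c + w.inputs n + b' := by omega
    refine ⟨_, ⟨_, hP, b', by omega, c + w.outputs n + b', by omega, rfl⟩, ?_⟩
    convert hQ using 1
    omega
  · rintro ⟨m, ⟨p, hP, b', rfl, b, hb, rfl⟩, hQ⟩
    obtain rfl : b = c + w.outputs n + b' := by omega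
    refine ⟨_, ⟨_, hP, c + w.inputs n + b', by omega, b', by omega, rfl⟩, ?_⟩
    convert hQ using 1
    omega

theorem LIso.isLayering_iff {n h k : ℕ} {l l' : List Layer} (H : LIso n l l') :
    IsLayering n h l k ↔ IsLayering n h l' k := by
  induction H with
  | rel _ _ H => exact H.isLayering_iff
  | refl => rfl
  | symm _ _ _ ih => exact ih.symm
  | trans _ _ _ _ _ ih ih' => exact ih.trans ih'

/-- Exchanges preserve the strand counts at both ends, so each list in a chain of exchanges is
itself a diagram. -/
theorem StrandDiagram.isotopic_iff {n h k : ℕ} {D D' : StrandDiagram n h k} :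
    D.Isotopic D' ↔ LIso n D.layers D'.layers := by
  constructor
  · intro H
    induction H with
    | rel _ _ H => exact Relation.EqvGen.rel _ _ H
    | refl => exact .refl _
    | symm _ _ _ ih => exact ih.symm
    | trans _ _ _ _ _ ih ih' => exact ih.trans ih'
  · suffices ∀ l l', LIso n l l' → ∀ (H : IsLayering n h l k) (H' : IsLayering n h l' k),
        Isotopic ⟨l, H⟩ ⟨l', H'⟩ from fun H => this _ _ H _ _
    intro l l' hl
    induction hl with
    | rel _ _ h => exact fun H H' => Relation.EqvGen.rel _ _ h
    | refl => exact fun H H' => Relation.EqvGen.refl _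
    | symm _ _ _ ih => exact fun H H' => Relation.EqvGen.symm _ _ (ih H' H)
    | trans _ _ _ h1 _ ih ih' =>
      exact fun H H' => Relation.EqvGen.trans _ _ _ (ih H ((LIso.isLayering_iff h1).1 H)) (ih' _ H')

/-- The layer obtained by adding `c` strands on the left. -/
def Layer.shift (c : ℕ) (u : Layer) : Layer := ⟨u.kind, c + u.left⟩

/-- Vertices of two diagrams standing beside each other can be drawn in either order. -/
theorem LIso.interchange {n h k : ℕ} {l : List Layer} (H : IsLayering n h l k) (c : ℕ)
    (l' : List Layer) :
    LIso n (l ++ l'.map (Layer.shift (k + c))) (l'.map (Layer.shift (h + c)) ++ l) := by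
  induction H generalizing c with
  | nil => exact .of_eq (by simp)
  | @cons v a b l k H ih =>
    -- A single vertex slides past the whole right-hand diagram, whose offset changes from outputs
    -- to inputs.
    have key : ∀ l' : List Layer, LIso n (⟨v, a⟩ :: l'.map (Layer.shift (a + v.outputs n + b + c)))
        (l'.map (Layer.shift (a + v.inputs n + b + c)) ++ [⟨v, a⟩]) := by
      intro l'
      induction l' with
      | nil => exact .refl _
      | cons u l' ih' =>
        have h1 := (LIso.swap n v u.kind a (b + c + u.left)).append_right
          (l'.map (Layer.shift (a + v.outputs n + b + c)))
        have h2 := ih'.append_left [⟨u.kind, a + v.inputs n + (b + c + u.left)⟩]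
        simp only [List.map_cons, Layer.shift, List.cons_append, List.nil_append, add_assoc]
          at h1 h2 ⊢
        exact h1.trans h2
    have h1 := (ih c).append_left [⟨v, a⟩]
    have h2 := (key l').append_right l
    simp only [List.cons_append, List.nil_append, List.append_assoc] at h1 h2 ⊢
    exact h1.trans h2

/-! ## Syntactic labels -/

/-- Formal labels of the edges of a strand diagram. -/
inductive StrandTerm (n : ℕ) : Type
  | src (i : ℕ) : StrandTerm n
  | spl (j : ℕ) (x : StrandTerm n) : StrandTerm n
  | mrg (c : Fin n → StrandTerm n) : StrandTerm n

instance (n : ℕ) : StrandAlgebra n (StrandTerm n) := ⟨.spl, .mrg⟩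

section Terms

open StrandTerm

variable {n : ℕ}

theorem outLabel_inj {v w : VertexKind} {i j : ℕ} {g g' : ℕ → StrandTerm n}
    (hi : i < v.outputs n) (hj : j < w.outputs n) (h : outLabel n v i g = outLabel n w j g') :
    v = w ∧ i = j ∧ ∀ k < v.inputs n, g k = g' k := by
  cases v <;> cases w <;> simp only [outLabel, StrandAlgebra.sp, StrandAlgebra.mg] at h
  · injection h with h1 h2
    refine ⟨rfl, h1, fun k hk => ?_⟩
    obtain rfl : k = 0 := Nat.lt_one_iff.1 hk
    exact h2
  · cases h
  · cases h
  · injection h with h1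
    have hi : i < 1 := hi
    have hj : j < 1 := hj
    exact ⟨rfl, by omega, fun k hk => congrFun h1 ⟨k, hk⟩⟩

theorem outLabel_ne_src (v : VertexKind) (j : ℕ) (g : ℕ → StrandTerm n) (i : ℕ) :
    outLabel n v j g ≠ src i := by
  cases v <;> simp [outLabel, StrandAlgebra.sp, StrandAlgebra.mg]

/-- The strands from position `a` on are labelled like the outgoing edges of a vertex of
kind `v`. -/
def IsOutput (v : VertexKind) (a : ℕ) (f : ℕ → StrandTerm n) : Prop :=
  ∃ g : ℕ → StrandTerm n, ∀ j < v.outputs n, f (a + j) = outLabel n v j g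

theorem isOutput_congr {v : VertexKind} {a b : ℕ} {f g : ℕ → StrandTerm n}
    (h : ∀ j < v.outputs n, f (a + j) = g (b + j)) : IsOutput v a f ↔ IsOutput v b g := by
  refine exists_congr fun x => forall_congr' fun j => forall_congr' fun hj => ?_
  rw [h j hj]

theorem isOutput_step (v : VertexKind) (a : ℕ) (f : ℕ → StrandTerm n) :
    IsOutput v a (step n ⟨v, a⟩ f) :=
  ⟨_, fun _ hj => step_out v a f hj⟩

theorem isOutput_step_left {v w : VertexKind} {a b : ℕ} {f : ℕ → StrandTerm n}
    (h : a + v.outputs n ≤ b) : IsOutput v a (step n ⟨w, b⟩ f) ↔ IsOutput v a f :=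
  isOutput_congr fun _ hj => step_left _ _ (by omega)

theorem isOutput_step_right {v w : VertexKind} {b c : ℕ} {f : ℕ → StrandTerm n} :
    IsOutput v (b + w.outputs n + c) (step n ⟨w, b⟩ f) ↔ IsOutput v (b + w.inputs n + c) f :=
  isOutput_congr fun j _ => by rw [add_assoc _ c j, step_right, add_assoc _ c j]

theorem not_isOutput_src (hn : 0 < n) (v : VertexKind) (a : ℕ) :
    ¬ IsOutput v a (src : ℕ → StrandTerm n) := by
  rintro ⟨g, hg⟩
  exact outLabel_ne_src _ _ _ _ (hg 0 (v.outputs_pos hn)).symm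

theorem intervals_disjoint_or_meet (a p b q : ℕ) (hp : 0 < p) (hq : 0 < q) :
    (∃ c, b = a + p + c) ∨ (∃ c, a = b + q + c) ∨ ∃ i < p, ∃ j < q, a + i = b + j := by
  by_cases h : a + p ≤ b
  · exact .inl ⟨b - (a + p), by omega⟩
  by_cases h' : b + q ≤ a
  · exact .inr (.inl ⟨a - (b + q), by omega⟩)
  · exact .inr (.inr ⟨max a b - a, by omega, max a b - b, by omega, by omega⟩)

/-- A formal label records the kind of the emitting vertex and the index of the edge, so one strand
shared with the outputs of the last vertex forces the two blocks to coincide. -/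
theorem isOutput_step_cases (hn : 0 < n) {v w : VertexKind} {a b : ℕ} {f : ℕ → StrandTerm n}
    (h : IsOutput v a (step n ⟨w, b⟩ f)) :
    (v = w ∧ a = b) ∨ (∃ c, b = a + v.outputs n + c ∧ IsOutput v a f) ∨
      ∃ c, a = b + w.outputs n + c ∧ IsOutput v (b + w.inputs n + c) f := by
  rcases intervals_disjoint_or_meet a _ b _ (v.outputs_pos hn) (w.outputs_pos hn) with
    ⟨c, hc⟩ | ⟨c, rfl⟩ | ⟨i, hi, j, hj, hij⟩
  · exact .inr (.inl ⟨c, hc, (isOutput_step_left (by omega)).1 h⟩)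
  · exact .inr (.inr ⟨c, rfl, isOutput_step_right.1 h⟩)
  · obtain ⟨g, hg⟩ := h
    have := hg i hi
    rw [hij, step_out _ _ _ hj] at this
    obtain ⟨rfl, rfl, -⟩ := outLabel_inj hj hi this
    exact .inl ⟨rfl, by omega⟩

/-- Vertices drawn after the emitting vertex leave its outputs untouched, so each lies entirely to
one side and can be exchanged with it. -/
theorem exists_liso_append_of_isOutput (hn : 0 < n) {v : VertexKind} {a : ℕ} {P : List Layer}
    (h : IsOutput v a (run n P (src : ℕ → StrandTerm n))) :
    ∃ P', LIso n P (P' ++ [⟨v, a⟩]) := by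
  induction P using List.reverseRecOn generalizing a with
  | nil => exact absurd h (not_isOutput_src hn v a)
  | append_singleton P u ih =>
    obtain ⟨w, b⟩ := u
    rw [run_append, run_cons, run_nil] at h
    rcases isOutput_step_cases hn h with ⟨rfl, rfl⟩ | ⟨c, rfl, h'⟩ | ⟨c, rfl, h'⟩
    · exact ⟨P, .refl _⟩
    · obtain ⟨P', hP⟩ := ih h'
      refine ⟨P' ++ [⟨w, a + v.inputs n + c⟩], (hP.append_right _).trans ?_⟩
      simpa using (LIso.swap n v w a c).append_left P'
    · obtain ⟨P', hP⟩ := ih h'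
      refine ⟨P' ++ [⟨w, b⟩], (hP.append_right _).trans ?_⟩
      simpa using (LIso.swap n w v b c).symm.append_left P'

theorem step_injective (hn : 0 < n) (u : Layer) :
    Function.Injective (step n u : (ℕ → StrandTerm n) → ℕ → StrandTerm n) := by
  obtain ⟨v, a⟩ := u
  intro f g h
  funext i
  -- Positions above a layer are positions below its reflection.
  have hc := layer_cases (n := n) v.flip a i
  rw [VertexKind.outputs_flip] at hc
  rcases hc with hi | ⟨j, hj, rfl⟩ | ⟨c, rfl⟩
  · rw [← step_left (n := n) v f hi, h, step_left v g hi]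
  · have h0 := v.outputs_pos hn
    have := congrFun h (a + 0)
    rw [step_out v a f h0, step_out v a g h0] at this
    exact (outLabel_inj h0 h0 this).2.2 j hj
  · rw [← step_right v a c f, h, step_right]

/-- The labels at the bottom determine a diagram up to isotopy. -/
theorem liso_of_run_eq (hn : 0 < n) {l l' : List Layer}
    (h : run n l (src : ℕ → StrandTerm n) = run n l' src) : LIso n l l' := by
  induction l using List.reverseRecOn generalizing l' with
  | nil =>
    induction l' using List.reverseRecOn with
    | nil => exact .refl _
    | append_singleton P u _ =>
      rw [run_append, run_cons, run_nil, run_nil] at h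
      exact absurd (h ▸ isOutput_step u.kind u.left _) (not_isOutput_src hn _ _)
  | append_singleton P u ih =>
    rw [run_append, run_cons, run_nil] at h
    -- The last vertex of one drawing is visible in the common labels, so the other can be redrawn
    -- to end with it; `step_injective` then strips it from both.
    obtain ⟨P', hP⟩ := exists_liso_append_of_isOutput hn (h ▸ isOutput_step u.kind u.left _)
    rw [hP.run_eq, run_append, run_cons, run_nil] at h
    exact ((ih (step_injective hn _ h)).append_right _).trans hP.symm

/-! ## Reduced diagrams have no redex -/

/-- No vertex cancels with vertices above it, if the strands at the top are labelled by `f`. -/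
def NoRedex : List Layer → (ℕ → StrandTerm n) → Prop
  | [], _ => True
  | u :: l, f => ¬ IsOutput u.kind.flip u.left f ∧ NoRedex l (step n u f)

theorem noRedex_append {l l' : List Layer} {f : ℕ → StrandTerm n} :
    NoRedex (l ++ l') f ↔ NoRedex l f ∧ NoRedex l' (run n l f) := by
  induction l generalizing f with
  | nil => simp [NoRedex]
  | cons u l ih => simp [NoRedex, ih, and_assoc]

theorem LIso.noRedex_iff {l l' : List Layer} (h : LIso n l l') (f : ℕ → StrandTerm n) :
    NoRedex l f ↔ NoRedex l' f := by
  induction h with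
  | rel l l' h =>
    obtain ⟨P, Q, v, w, a, c, rfl, rfl⟩ := h
    have h1 : IsOutput v.flip a (step n ⟨w, a + v.inputs n + c⟩ (run n P f)) ↔
        IsOutput v.flip a (run n P f) :=
      isOutput_step_left (by rw [VertexKind.outputs_flip]; omega)
    simp only [noRedex_append, NoRedex, run_append, run_cons, run_nil, step_exchange,
      isOutput_step_right, h1]
    tauto
  | refl => rfl
  | symm _ _ _ ih => exact ih.symm
  | trans _ _ _ _ _ ih ih' => exact ih.trans ih'

theorem exists_redex {l : List Layer} {f : ℕ → StrandTerm n} (h : ¬ NoRedex l f) :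
    ∃ P v a R, l = P ++ [⟨v, a⟩] ++ R ∧ NoRedex P f ∧ IsOutput v.flip a (run n P f) := by
  induction l generalizing f with
  | nil => exact absurd trivial h
  | cons u l ih =>
    by_cases hu : IsOutput u.kind.flip u.left f
    · exact ⟨[], u.kind, u.left, l, rfl, trivial, hu⟩
    · obtain ⟨P, v, a, R, rfl, hP, hR⟩ := ih fun h' => h ⟨hu, h'⟩
      exact ⟨u :: P, v, a, R, by simp, ⟨hu, hP⟩, hR⟩

theorem isLayering_cancel {h k a : ℕ} {v : VertexKind} {P Q : List Layer}
    (H : IsLayering n h (P ++ [⟨v, a⟩, ⟨v.flip, a⟩] ++ Q) k) : IsLayering n h (P ++ Q) k := by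
  simp only [isLayering_append_iff, isLayering_cons_iff, isLayering_nil_iff,
    VertexKind.inputs_flip, VertexKind.outputs_flip] at H ⊢
  obtain ⟨m, ⟨p, hP, b, rfl, b', hb', rfl⟩, hQ⟩ := H
  obtain rfl : b = b' := by omega
  exact ⟨_, hP, hQ⟩

/-- A partner visible in the labels can be drawn immediately above the vertex it cancels.
Conversely, an adjacent cancelling pair violates `NoRedex`, which is isotopy invariant. -/
theorem StrandDiagram.isReduced_iff_noRedex (hn : 0 < n) {h k : ℕ} {D : StrandDiagram n h k} :
    D.IsReduced ↔ NoRedex D.layers (src : ℕ → StrandTerm n) := by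
  constructor
  · intro hD
    by_contra hr
    obtain ⟨P, v, a, R, hl, -, hout⟩ := exists_redex hr
    obtain ⟨P', hP⟩ := exists_liso_append_of_isOutput hn hout
    have hiso : LIso n D.layers (P' ++ [⟨v.flip, a⟩, ⟨v.flip.flip, a⟩] ++ R) := by
      rw [hl, VertexKind.flip_flip]
      have := hP.append_right ([⟨v, a⟩] ++ R)
      rw [← List.append_assoc] at this
      refine this.trans (.of_eq (by simp))
    have hC := hiso.isLayering_iff.1 D.isLayering
    exact hD ⟨P' ++ R, isLayering_cancel hC⟩ ⟨⟨_, hC⟩, _, isotopic_iff.2 hiso,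
      ⟨P', R, v.flip, a, rfl, rfl⟩, Relation.EqvGen.refl _⟩
  · rintro hD D' ⟨C, C', hC, ⟨P, Q, v, a, h1, h2⟩, -⟩
    rw [(isotopic_iff.1 hC).noRedex_iff, h1] at hD
    simp only [noRedex_append, NoRedex, VertexKind.flip_flip] at hD
    exact hD.1.2.2.1 (isOutput_step v a _)

/-! ## Normal forms -/

/-- Terms in which no operation is applied to the result of its inverse operation. -/
def StrandTerm.Normal : StrandTerm n → Prop
  | src _ => True
  | spl _ x => x.Normal ∧ ∀ c, x ≠ mrg c
  | mrg c => (∀ j, (c j).Normal) ∧ ¬ ∃ x, ∀ j : Fin n, c j = spl j x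

/-- The free algebra in which the operations are inverse to each other. -/
@[ext]
structure NormalTerm (n : ℕ) : Type where
  /-- The underlying term. -/
  val : StrandTerm n
  normal : val.Normal

namespace NormalTerm

open Classical in
/-- The merge of normal terms. -/
noncomputable def merge (c : Fin n → NormalTerm n) : NormalTerm n :=
  if h : ∃ x, ∀ j : Fin n, (c j).1 = spl j x then
    -- For `n > 0` the default is never reached: `h.choose` is a subterm of a normal term.
    if hx : h.choose.Normal then ⟨h.choose, hx⟩ else ⟨.src 0, trivial⟩
  else ⟨mrg fun j => (c j).1, fun j => (c j).2, h⟩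

end NormalTerm

noncomputable instance (n : ℕ) : StrandAlgebra n (NormalTerm n) where
  sp j
    | ⟨src i, h⟩ => ⟨spl j (src i), h, by simp⟩
    | ⟨spl k x, h⟩ => ⟨spl j (spl k x), h, by simp⟩
    | ⟨mrg c, h⟩ => if hj : j < n then ⟨c ⟨j, hj⟩, h.1 _⟩ else ⟨src 0, trivial⟩
  mg := NormalTerm.merge

namespace NormalTerm

theorem sp_val {j : ℕ} {x : NormalTerm n} (h : ∀ c, x.1 ≠ mrg c) :
    (StrandAlgebra.sp n j x).1 = spl j x.1 := by
  obtain ⟨x, hx⟩ := x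
  cases x with
  | src => rfl
  | spl => rfl
  | mrg c => exact absurd rfl (h c)

theorem sp_mrg {j : ℕ} (hj : j < n) {c : Fin n → StrandTerm n} (h : (mrg c).Normal) :
    (StrandAlgebra.sp n j (⟨mrg c, h⟩ : NormalTerm n)).1 = c ⟨j, hj⟩ := by
  change (dite (j < n) _ _ : NormalTerm n).1 = _
  rw [dif_pos hj]

theorem mg_val {c : Fin n → NormalTerm n} (h : ¬ ∃ x, ∀ j : Fin n, (c j).1 = spl j x) :
    (StrandAlgebra.mg c).1 = mrg fun j => (c j).1 := by
  change (merge c).val = _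
  rw [merge, dif_neg h]

theorem mg_spl (hn : 0 < n) {c : Fin n → NormalTerm n} {x : StrandTerm n}
    (h : ∀ j : Fin n, (c j).1 = spl j x) : (StrandAlgebra.mg c).1 = x := by
  have hex : ∃ x, ∀ j : Fin n, (c j).1 = spl j x := ⟨x, h⟩
  have hx : hex.choose = x := by
    have h1 := hex.choose_spec ⟨0, hn⟩
    rw [h ⟨0, hn⟩] at h1
    injection h1 with _ h1
    exact h1.symm
  have hxn : x.Normal := by
    have := (c ⟨0, hn⟩).2
    rw [h] at this
    exact this.1
  change (merge c).val = _
  rw [merge, dif_pos hex, dif_pos (hx ▸ hxn)]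
  exact hx

theorem mg_sp (hn : 0 < n) (x : NormalTerm n) :
    (StrandAlgebra.mg fun j : Fin n => StrandAlgebra.sp n j x) = x := by
  by_cases h : ∃ c, x.1 = mrg c
  · obtain ⟨x, hx⟩ := x
    obtain ⟨c, rfl⟩ := h
    refine NormalTerm.ext ?_
    rw [mg_val]
    · simp only [sp_mrg (Fin.is_lt _)]
    · simp only [sp_mrg (Fin.is_lt _)]
      exact hx.2
  · push Not at h
    exact NormalTerm.ext (mg_spl hn fun j => sp_val h)

theorem sp_mg (hn : 0 < n) (c : Fin n → NormalTerm n) (j : Fin n) :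
    StrandAlgebra.sp n j (StrandAlgebra.mg c) = c j := by
  by_cases h : ∃ x, ∀ j : Fin n, (c j).1 = spl j x
  · obtain ⟨x, hx⟩ := h
    refine NormalTerm.ext ?_
    have hm := mg_spl hn hx
    rw [sp_val, hm, hx]
    intro d hd
    have := (c j).2
    rw [hx, ← hm] at this
    exact this.2 d hd
  · have hm := mg_val h
    obtain ⟨y, hy⟩ : ∃ y, y = StrandAlgebra.mg c := ⟨_, rfl⟩
    rw [← hy] at hm ⊢
    obtain ⟨y, hyn⟩ := y
    obtain rfl : y = _ := hm
    exact NormalTerm.ext (sp_mrg j.2 hyn)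

/-- On labels, `mg_sp` is the move of type I and `sp_mg` the move of type II. -/
theorem outLabel_flip (hn : 0 < n) (v : VertexKind) {j : ℕ} (hj : j < v.inputs n)
    (g : ℕ → NormalTerm n) :
    outLabel n v.flip j (fun i => outLabel n v i g) = g j := by
  cases v
  · obtain rfl : j = 0 := Nat.lt_one_iff.1 hj
    exact mg_sp hn _
  · exact sp_mg hn (fun j => g j) ⟨j, hj⟩

theorem step_flip (hn : 0 < n) (v : VertexKind) (a : ℕ) (f : ℕ → NormalTerm n) :
    step n ⟨v.flip, a⟩ (step n ⟨v, a⟩ f) = f := by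
  funext i
  rcases layer_cases (n := n) v.flip a i with h | ⟨j, hj, rfl⟩ | ⟨c, rfl⟩
  · rw [step_left _ _ h, step_left _ _ h]
  · rw [step_out _ _ _ hj]
    rw [VertexKind.outputs_flip] at hj
    refine Eq.trans (outLabel_congr _ _ fun i hi => ?_) (outLabel_flip hn v hj fun j => f (a + j))
    rw [VertexKind.inputs_flip] at hi
    exact step_out _ _ _ hi
  · rw [step_right, VertexKind.inputs_flip, VertexKind.outputs_flip, step_right]

/-- The labels at the top of a diagram. -/
def src (i : ℕ) : NormalTerm n := ⟨.src i, trivial⟩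

theorem val_outLabel (v : VertexKind) {a j : ℕ} (f : ℕ → NormalTerm n) (hj : j < v.outputs n)
    (h : ¬ IsOutput v.flip a (val ∘ f)) :
    (outLabel n v j fun i => f (a + i)).1 = outLabel n v j fun i => (f (a + i)).1 := by
  cases v
  · refine sp_val fun c hc => h ⟨fun i => if hi : i < n then c ⟨i, hi⟩ else .src 0, ?_⟩
    intro j hj
    obtain rfl : j = 0 := Nat.lt_one_iff.1 hj
    simpa [outLabel, StrandAlgebra.mg, VertexKind.flip] using hc
  · refine mg_val ?_
    rintro ⟨x, hx⟩
    exact h ⟨fun _ => x, fun j hj => hx ⟨j, hj⟩⟩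

/-- Without a redex no operation on normal terms ever simplifies, so it is computed formally. -/
theorem val_run {l : List Layer} {f : ℕ → NormalTerm n} (h : NoRedex l (val ∘ f)) :
    val ∘ run n l f = run n l (val ∘ f) := by
  induction l generalizing f with
  | nil => rfl
  | cons u l ih =>
    have hu : val ∘ step n u f = step n u (val ∘ f) := by
      obtain ⟨v, a⟩ := u
      funext i
      rcases layer_cases (n := n) v a i with hi | ⟨j, hj, rfl⟩ | ⟨c, rfl⟩
      · rw [Function.comp_apply, step_left _ _ hi, step_left _ _ hi, Function.comp_apply]
      · rw [Function.comp_apply, step_out _ _ _ hj, step_out _ _ _ hj, val_outLabel v f hj h.1]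
        rfl
      · rw [Function.comp_apply, step_right, step_right, Function.comp_apply]
    rw [run_cons, run_cons, ← hu]
    exact ih (hu ▸ h.2)

end NormalTerm

end Terms

/-! ## Equivalence of diagrams -/

/-- The action of a list of layers on labels in the free algebra. -/
noncomputable def act (n : ℕ) (l : List Layer) : (ℕ → NormalTerm n) → ℕ → NormalTerm n :=
  run n l

theorem act_append {n : ℕ} (l l' : List Layer) : act n (l ++ l') = act n l' ∘ act n l := by
  funext f
  exact run_append l l' f

theorem LIso.act_eq {n : ℕ} {l l' : List Layer} (h : LIso n l l') : act n l = act n l' := h.run_eq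

theorem act_cancel {n : ℕ} (hn : 0 < n) (v : VertexKind) (a : ℕ) :
    act n [⟨v, a⟩, ⟨v.flip, a⟩] = id := by
  funext f
  exact NormalTerm.step_flip hn v a f

namespace StrandDiagram

variable {n h k : ℕ}

theorem Reduction.act_eq (hn : 0 < n) {D D' : StrandDiagram n h k} (H : Reduction D D') :
    act n D.layers = act n D'.layers := by
  obtain ⟨C, C', h1, ⟨P, Q, v, a, hC, hC'⟩, h2⟩ := H
  rw [(isotopic_iff.1 h1).act_eq, ← (isotopic_iff.1 h2).act_eq, hC, hC', act_append, act_append,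
    act_append, act_cancel hn, Function.id_comp]

theorem Reduction.length_lt {D D' : StrandDiagram n h k} (H : Reduction D D') :
    D'.layers.length < D.layers.length := by
  obtain ⟨C, C', h1, ⟨P, Q, v, a, hC, hC'⟩, h2⟩ := H
  rw [(isotopic_iff.1 h1).length_eq, ← (isotopic_iff.1 h2).length_eq, hC, hC']
  simp

theorem Equivalent.act_eq (hn : 0 < n) {D D' : StrandDiagram n h k} (H : Equivalent D D') :
    act n D.layers = act n D'.layers := by
  induction H with
  | rel _ _ H => exact H.elim (fun H => (isotopic_iff.1 H).act_eq) fun H => H.act_eq hn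
  | refl => rfl
  | symm _ _ _ ih => exact ih.symm
  | trans _ _ _ _ _ ih ih' => exact ih.trans ih'

theorem exists_equivalent_isReduced (D : StrandDiagram n h k) :
    ∃ D', Equivalent D D' ∧ D'.IsReduced ∧ D'.layers.length ≤ D.layers.length := by
  induction hl : D.layers.length using Nat.strong_induction_on generalizing D with
  | _ l ih =>
    by_cases hD : D.IsReduced
    · exact ⟨D, Relation.EqvGen.refl _, hD, hl.le⟩
    · unfold IsReduced at hD
      push Not at hD
      obtain ⟨D', hD'⟩ := hD
      have hlt := hD'.length_lt
      obtain ⟨D'', h1, h2, h3⟩ := ih _ (hl ▸ hlt) D' rfl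
      exact ⟨D'', Relation.EqvGen.trans _ _ _ (Relation.EqvGen.rel _ _ (.inr hD')) h1, h2,
        by omega⟩

/-- Uniqueness of reduced forms without a confluence argument: by `val_run` the action on the
sources returns the formal labels, which determine the drawing. -/
theorem IsReduced.liso (hn : 0 < n) {D D' : StrandDiagram n h k} (hD : D.IsReduced)
    (hD' : D'.IsReduced) (H : act n D.layers = act n D'.layers) : LIso n D.layers D'.layers := by
  refine liso_of_run_eq hn ?_
  have h1 := NormalTerm.val_run (f := NormalTerm.src) ((isReduced_iff_noRedex hn).1 hD)
  have h2 := NormalTerm.val_run (f := NormalTerm.src) ((isReduced_iff_noRedex hn).1 hD')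
  exact h1.symm.trans ((congrArg (NormalTerm.val ∘ ·) (congrFun H NormalTerm.src)).trans h2)

theorem equivalent_iff (hn : 0 < n) {D D' : StrandDiagram n h k} :
    Equivalent D D' ↔ act n D.layers = act n D'.layers := by
  refine ⟨Equivalent.act_eq hn, fun H => ?_⟩
  obtain ⟨E, h1, h2, -⟩ := exists_equivalent_isReduced D
  obtain ⟨E', h1', h2', -⟩ := exists_equivalent_isReduced D'
  have h3 := h2.liso hn h2' ((h1.act_eq hn).symm.trans (H.trans (h1'.act_eq hn)))
  exact Relation.EqvGen.trans _ _ _ h1 (Relation.EqvGen.trans _ _ _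
    (Relation.EqvGen.rel _ _ (.inl (isotopic_iff.2 h3))) (Relation.EqvGen.symm _ _ h1'))

/-- A diagram is reduced if and only if it is a smallest representative of its class. -/
theorem isReduced_iff_le (hn : 0 < n) {D : StrandDiagram n h k} :
    D.IsReduced ↔ ∀ D' : StrandDiagram n h k, act n D'.layers = act n D.layers →
      D.layers.length ≤ D'.layers.length := by
  constructor
  · intro hD D' H
    obtain ⟨E, h1, h2, h3⟩ := exists_equivalent_isReduced D'
    rw [(hD.liso hn h2 (H.symm.trans (h1.act_eq hn))).length_eq]
    exact h3
  · intro H D' hD'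
    have := H D' (hD'.act_eq hn).symm
    have := hD'.length_lt
    omega

end StrandDiagram

/-! ## Substitution -/

section Substitution

open StrandTerm

variable {n : ℕ}

/-- Substitution of the terms `f i` for the sources. -/
def StrandTerm.bind (f : ℕ → StrandTerm n) : StrandTerm n → StrandTerm n
  | src i => f i
  | spl j x => spl j (x.bind f)
  | mrg c => mrg fun j => (c j).bind f

theorem isStrandHom_bind (f : ℕ → StrandTerm n) : IsStrandHom n (StrandTerm.bind f) :=
  ⟨fun _ _ => rfl, fun _ => rfl⟩

theorem run_eq_bind (l : List Layer) (f : ℕ → StrandTerm n) (i : ℕ) :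
    run n l f i = (run n l src i).bind f :=
  (congrFun ((isStrandHom_bind f).run l src) i).symm

theorem bind_bind (f g : ℕ → StrandTerm n) (t : StrandTerm n) :
    (t.bind g).bind f = t.bind fun i => (g i).bind f := by
  induction t with
  | src => rfl
  | spl j x ih => simp only [StrandTerm.bind, ih]
  | mrg c ih => simp only [StrandTerm.bind, ih]

theorem eq_of_outLabel_eq {v w : VertexKind} {i j : ℕ} {g g' : ℕ → StrandTerm n}
    (h : outLabel n v i g = outLabel n w j g') : v = w ∧ ∀ k < v.inputs n, g k = g' k := by
  cases v <;> cases w <;> simp only [outLabel, StrandAlgebra.sp, StrandAlgebra.mg] at h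
  · injection h with h1 h2
    refine ⟨rfl, fun k hk => ?_⟩
    obtain rfl : k = 0 := Nat.lt_one_iff.1 hk
    exact h2
  · cases h
  · cases h
  · injection h with h1
    exact ⟨rfl, fun k hk => congrFun h1 ⟨k, hk⟩⟩

theorem exists_eq_src_or_outLabel (t : StrandTerm n) :
    (∃ i, t = src i) ∨ ∃ v j g, t = outLabel n v j g := by
  cases t with
  | src i => exact .inl ⟨i, rfl⟩
  | spl j x => exact .inr ⟨.split, j, fun _ => x, rfl⟩
  | mrg c =>
    refine .inr ⟨.merge, 0, fun i => if h : i < n then c ⟨i, h⟩ else src 0, ?_⟩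
    simp [outLabel, StrandAlgebra.mg]

theorem step_src_ne_src (v : VertexKind) (a : ℕ) {j : ℕ} (hj : j < v.inputs n) (i : ℕ) :
    step n ⟨v, a⟩ (src : ℕ → StrandTerm n) i ≠ src (a + j) := by
  rcases layer_cases (n := n) v a i with h | ⟨k, hk, rfl⟩ | ⟨c, rfl⟩
  · rw [step_left _ _ h]
    intro h'
    injection h'
    omega
  · rw [step_out _ _ _ hk]
    exact outLabel_ne_src _ _ _ _
  · rw [step_right]
    intro h'
    injection h'
    omega

/-- A label below one layer is a source or a vertex applied directly to sources. In the second case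
those sources are consumed and label no strand below, so substitution into a compound term cannot
produce it. -/
theorem step_src_ne_outLabel (hn : 0 < n) (u : Layer) (i : ℕ) (v : VertexKind) (j : ℕ)
    (g : ℕ → StrandTerm n) :
    step n u src i ≠ outLabel n v j (StrandTerm.bind (step n u src) ∘ g) := by
  obtain ⟨w, a⟩ := u
  intro h
  rcases layer_cases (n := n) w a i with hi | ⟨k, hk, rfl⟩ | ⟨c, rfl⟩
  · rw [step_left _ _ hi] at h
    exact outLabel_ne_src _ _ _ _ h.symm
  · rw [step_out _ _ _ hk] at h
    have h0 := (eq_of_outLabel_eq h).2 0 (w.inputs_pos hn)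
    rw [Function.comp_apply] at h0
    cases hg : g 0 with
    | src i =>
      rw [hg] at h0
      exact step_src_ne_src w a (w.inputs_pos hn) i h0.symm
    | spl j x => rw [hg] at h0; cases h0
    | mrg c => rw [hg] at h0; cases h0
  · rw [step_right] at h
    exact outLabel_ne_src _ _ _ _ h.symm

theorem step_src_injective (u : Layer) :
    Function.Injective (step n u (src : ℕ → StrandTerm n)) := by
  obtain ⟨v, a⟩ := u
  intro i i' h
  have key : ∀ i, (∃ k, step n ⟨v, a⟩ src i = (src k : StrandTerm n) ∧ (i < a ∧ k = i ∨
      ∃ c, i = a + v.outputs n + c ∧ k = a + v.inputs n + c)) ∨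
      ∃ j < v.outputs n, i = a + j ∧
        step n ⟨v, a⟩ src i = outLabel n v j fun j => (src (a + j) : StrandTerm n) := by
    intro i
    rcases layer_cases (n := n) v a i with hi | ⟨j, hj, rfl⟩ | ⟨c, rfl⟩
    · exact .inl ⟨i, step_left _ _ hi, .inl ⟨hi, rfl⟩⟩
    · exact .inr ⟨j, hj, rfl, step_out _ _ _ hj⟩
    · exact .inl ⟨_, step_right _ _ _ _, .inr ⟨c, rfl, rfl⟩⟩
  rcases key i with ⟨k, hk, hi⟩ | ⟨j, hj, rfl, hi⟩ <;>
  rcases key i' with ⟨k', hk', hi'⟩ | ⟨j', hj', rfl, hi'⟩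
  · rw [hk, hk'] at h
    injection h with h
    rcases hi with hi | ⟨c, hi⟩ <;> rcases hi' with hi' | ⟨c', hi'⟩ <;> omega
  · rw [hk, hi'] at h
    exact absurd h.symm (outLabel_ne_src _ _ _ _)
  · rw [hk', hi] at h
    exact absurd h (outLabel_ne_src _ _ _ _)
  · rw [hi, hi'] at h
    rw [(outLabel_inj hj hj' h).2.1]

theorem bind_step_injective (hn : 0 < n) (u : Layer) :
    Function.Injective (StrandTerm.bind (step n u (src : ℕ → StrandTerm n))) := by
  have key : ∀ i v j (g : ℕ → StrandTerm n),
      step n u src i = (outLabel n v j g).bind (step n u src) → False := by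
    intro i v j g h
    rw [(isStrandHom_bind _).outLabel] at h
    exact step_src_ne_outLabel hn u i v j g h
  have key' : ∀ i (t : StrandTerm n), step n u src i = t.bind (step n u src) → t = src i := by
    intro i t h
    rcases exists_eq_src_or_outLabel t with ⟨i', rfl⟩ | ⟨v, j, g, rfl⟩
    · rw [step_src_injective u h]
    · exact (key i v j g h).elim
  intro t
  induction t with
  | src i => exact fun t' h => (key' i t' h).symm
  | spl j x ih =>
    intro t' h
    cases t' with
    | src i => exact key' i _ h.symm
    | spl k y =>
      injection h with h1 h2
      rw [h1, ih h2]
    | mrg d => cases h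
  | mrg c ih =>
    intro t' h
    cases t' with
    | src i => exact key' i _ h.symm
    | spl k y => cases h
    | mrg d =>
      injection h with h1
      congr 1
      funext k
      exact ih k (congrFun h1 k)

/-- Substituting the labels of a diagram is a composite of one-layer substitutions, each injective.
This lets equations between labels be pulled back below a diagram placed on top. -/
theorem bind_run_injective (hn : 0 < n) (l : List Layer) :
    Function.Injective (StrandTerm.bind (run n l (src : ℕ → StrandTerm n))) := by
  induction l using List.reverseRecOn with
  | nil =>
    have : StrandTerm.bind (src : ℕ → StrandTerm n) = id := by
      funext t
      induction t with
      | src => rfl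
      | spl j x ih => simp only [StrandTerm.bind, ih, id]
      | mrg c ih => simp only [StrandTerm.bind, ih, id]
    rw [run_nil, this]
    exact Function.injective_id
  | append_singleton l u ih =>
    intro t t' h
    have hb : run n (l ++ [u]) (src : ℕ → StrandTerm n) =
        fun i => (step n u src i).bind (run n l src) := by
      funext i
      rw [run_append]
      exact run_eq_bind [u] _ i
    rw [hb, ← bind_bind, ← bind_bind] at h
    exact bind_step_injective hn u (ih h)

/-! ## Vertices that cancel with vertices of a diagram further up -/

/-- If some input of `w` came from a vertex of `Q`, that vertex would be the cancelling partner; by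
injectivity of substitution all inputs would then come from it inside `Q`. So a vertex that cancels
only after `X` is added is fed by strands crossing `Q`. -/
theorem exists_src_of_isOutput (hn : 0 < n) {X Q : List Layer} {w : VertexKind} {b : ℕ}
    (h1 : ¬ IsOutput w.flip b (run n Q (src : ℕ → StrandTerm n)))
    (h2 : IsOutput w.flip b (run n (X ++ Q) (src : ℕ → StrandTerm n))) :
    ∀ j < w.inputs n, ∃ i, run n Q (src : ℕ → StrandTerm n) (b + j) = src i := by
  intro j hj
  obtain ⟨g, hg⟩ := h2
  simp only [run_append, run_eq_bind Q (run n X (src : ℕ → StrandTerm n)),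
    VertexKind.outputs_flip] at hg
  refine (exists_eq_src_or_outLabel (run n Q (src : ℕ → StrandTerm n) (b + j))).resolve_right ?_
  rintro ⟨v, k, g', hv⟩
  have h3 := hg j hj
  rw [hv, (isStrandHom_bind _).outLabel] at h3
  obtain ⟨rfl, h4⟩ := eq_of_outLabel_eq h3
  refine h1 ⟨g', fun i hi => bind_run_injective hn X ?_⟩
  rw [VertexKind.outputs_flip] at hi
  rw [hg i hi, (isStrandHom_bind _).outLabel]
  exact outLabel_congr _ _ fun k hk => (h4 k hk).symm

/-- No vertex of `Q` emits an input of `w`, so each one lies to one side of those strands and `w`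
can be exchanged upwards past it. -/
theorem exists_liso_cons (hn : 0 < n) {Q : List Layer} {w : VertexKind} {b : ℕ}
    (h : ∀ j < w.inputs n, ∃ i, run n Q (src : ℕ → StrandTerm n) (b + j) = src i) :
    ∃ c Q', LIso n (Q ++ [⟨w, b⟩]) ([⟨w, c⟩] ++ Q') ∧
      ∀ j < w.inputs n, run n Q (src : ℕ → StrandTerm n) (b + j) = src (c + j) := by
  induction Q using List.reverseRecOn generalizing b with
  | nil => exact ⟨b, [], .refl _, fun _ _ => rfl⟩
  | append_singleton Q u ih =>
    obtain ⟨x, e⟩ := u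
    simp only [run_append, run_cons, run_nil] at h ⊢
    rcases intervals_disjoint_or_meet b _ e _ (w.inputs_pos hn) (x.outputs_pos hn) with
      ⟨d, rfl⟩ | ⟨d, rfl⟩ | ⟨i, hi, j, hj, hij⟩
    · have hs : ∀ j < w.inputs n, step n ⟨x, b + w.inputs n + d⟩ (run n Q src) (b + j)
          = (run n Q src (b + j) : StrandTerm n) := fun j hj => step_left _ _ (by omega)
      obtain ⟨c, Q', h1, h2⟩ := ih fun j hj => hs j hj ▸ h j hj
      refine ⟨c, Q' ++ [⟨x, b + w.outputs n + d⟩], ?_, fun j hj => (hs j hj).trans (h2 j hj)⟩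
      have h3 := (LIso.swap n w x b d).symm.append_left Q
      have h4 := h1.append_right [⟨x, b + w.outputs n + d⟩]
      simp only [List.append_assoc, List.cons_append, List.nil_append] at h3 h4 ⊢
      exact h3.trans h4
    · have hs : ∀ j < w.inputs n, step n ⟨x, e⟩ (run n Q src) (e + x.outputs n + d + j)
          = (run n Q src (e + x.inputs n + d + j) : StrandTerm n) := fun j hj => by
        rw [add_assoc _ d j, step_right, add_assoc _ d j]
      obtain ⟨c, Q', h1, h2⟩ := ih fun j hj => hs j hj ▸ h j hj
      refine ⟨c, Q' ++ [⟨x, e⟩], ?_, fun j hj => (hs j hj).trans (h2 j hj)⟩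
      have h3 := (LIso.swap n x w e d).append_left Q
      have h4 := h1.append_right [⟨x, e⟩]
      simp only [List.append_assoc, List.cons_append, List.nil_append] at h3 h4 ⊢
      exact h3.trans h4
    · obtain ⟨k, hk⟩ := h i hi
      rw [hij, step_out _ _ _ hj] at hk
      exact absurd hk (outLabel_ne_src _ _ _ _)

theorem isOutput_of_run_eq {X Q : List Layer} {v : VertexKind} {b c : ℕ}
    (h : IsOutput v b (run n (X ++ Q) (src : ℕ → StrandTerm n)))
    (hc : ∀ j < v.outputs n, run n Q (src : ℕ → StrandTerm n) (b + j) = src (c + j)) :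
    IsOutput v c (run n X (src : ℕ → StrandTerm n)) := by
  refine (isOutput_congr fun j hj => ?_).1 h
  rw [run_append, run_eq_bind, hc j hj, StrandTerm.bind]

/-! ## Strands which pass through a diagram -/

/-- Planarity: strands that pass through do not cross. -/
theorem run_src_lt {l : List Layer} {i i' k k' : ℕ}
    (hi : run n l (src : ℕ → StrandTerm n) i = src i')
    (hk : run n l (src : ℕ → StrandTerm n) k = src k') (h : i < k) : i' < k' := by
  induction l using List.reverseRecOn generalizing i k with
  | nil =>
    injection hi
    injection hk
    omega
  | append_singleton l u ih =>
    obtain ⟨v, a⟩ := u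
    rw [run_append, run_cons, run_nil] at hi hk
    rcases layer_cases (n := n) v a i with hi' | ⟨j, hj, rfl⟩ | ⟨c, rfl⟩
    · rcases layer_cases (n := n) v a k with hk' | ⟨j', hj', rfl⟩ | ⟨c', rfl⟩
      · rw [step_left _ _ hi'] at hi
        rw [step_left _ _ hk'] at hk
        exact ih hi hk h
      · rw [step_out _ _ _ hj'] at hk
        exact absurd hk (outLabel_ne_src _ _ _ _)
      · rw [step_left _ _ hi'] at hi
        rw [step_right] at hk
        exact ih hi hk (by omega)
    · rw [step_out _ _ _ hj] at hi
      exact absurd hi (outLabel_ne_src _ _ _ _)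
    · obtain ⟨c', rfl⟩ : ∃ c', k = a + v.outputs n + c' := ⟨k - (a + v.outputs n), by omega⟩
      rw [step_right] at hi hk
      exact ih hi hk (by omega)

theorem IsLayering.run_right {α : Type} [StrandAlgebra n α] {h k : ℕ} {l : List Layer}
    (H : IsLayering n h l k) (f : ℕ → α) (d : ℕ) : run n l f (k + d) = f (h + d) := by
  induction H generalizing f with
  | nil => rfl
  | cons v a b _ ih => rw [run_cons, ih, add_assoc _ b d, step_right, add_assoc _ b d]

theorem IsLayering.src_lt {h k i i' : ℕ} {l : List Layer} (H : IsLayering n h l k)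
    (hi : run n l (src : ℕ → StrandTerm n) i = src i') (hk : i < k) : i' < h :=
  run_src_lt hi (H.run_right src 0) hk

/-- The concatenation of `p` copies of a list of layers. -/
def listPower (l : List Layer) (p : ℕ) : List Layer := (List.replicate p l).flatten

theorem listPower_zero (l : List Layer) : listPower l 0 = [] := rfl

theorem listPower_succ (l : List Layer) (p : ℕ) : listPower l (p + 1) = l ++ listPower l p := rfl

theorem listPower_add (l : List Layer) (p q : ℕ) :
    listPower l (p + q) = listPower l p ++ listPower l q := by
  rw [listPower, List.replicate_add, List.flatten_append]
  rfl

theorem listPower_one (l : List Layer) : listPower l 1 = l := by simp [listPower]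

theorem listPower_succ' (l : List Layer) (p : ℕ) : listPower l (p + 1) = listPower l p ++ l := by
  rw [listPower_add, listPower_one]

theorem length_listPower (l : List Layer) (p : ℕ) : (listPower l p).length = p * l.length := by
  simp [listPower]

theorem StrandDiagram.layers_power {m : ℕ} (E : StrandDiagram n m m) (p : ℕ) :
    (E.power p).layers = listPower E.layers p := by
  induction p with
  | zero => rfl
  | succ p ih => rw [listPower_succ', ← ih]; rfl

theorem IsLayering.listPower {m : ℕ} {l : List Layer} (H : IsLayering n m l m) (p : ℕ) :
    IsLayering n m (listPower l p) m := by
  induction p with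
  | zero => exact .nil _
  | succ p ih => exact H.append ih

theorem LIso.listPower {l l' : List Layer} (h : LIso n l l') (p : ℕ) :
    LIso n (listPower l p) (listPower l' p) := by
  induction p with
  | zero => exact .refl _
  | succ p ih => exact h.append ih

theorem run_append_eq_src {l l' : List Layer} {i i' : ℕ}
    (h : run n (l ++ l') (src : ℕ → StrandTerm n) i = src i') :
    ∃ k, run n l' (src : ℕ → StrandTerm n) i = src k ∧
      run n l (src : ℕ → StrandTerm n) k = src i' := by
  rw [run_append, run_eq_bind] at h
  cases ht : run n l' (src : ℕ → StrandTerm n) i with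
  | src k => exact ⟨k, rfl, by rwa [ht] at h⟩
  | spl j x => rw [ht] at h; cases h
  | mrg c => rw [ht] at h; cases h

/-- By monotonicity, a drift across one copy repeats in the same direction across every copy, by at
least one position each time. -/
theorem run_listPower_src {l : List Layer} {q i k i' : ℕ}
    (h1 : run n l (src : ℕ → StrandTerm n) i = src k)
    (h2 : run n (listPower l q) (src : ℕ → StrandTerm n) i = src i') :
    (k < i → i' + q ≤ i) ∧ (k = i → i' = i) ∧ (i < k → i + q ≤ i') := by
  induction q generalizing i k with
  | zero =>
    injection h2 with h2
    omega
  | succ q ih =>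
    rw [listPower_succ'] at h2
    obtain ⟨k', h3, h4⟩ := run_append_eq_src h2
    rw [h1] at h3
    injection h3 with h3
    subst h3
    cases q with
    | zero =>
      injection h4 with h4
      omega
    | succ q =>
      have h5 := h4
      rw [listPower_succ'] at h5
      obtain ⟨k2, h5, -⟩ := run_append_eq_src h5
      obtain ⟨ih1, ih2, ih3⟩ := ih h5 h4
      refine ⟨fun h => ?_, fun h => ?_, fun h => ?_⟩
      · have := ih1 (run_src_lt h5 h1 h)
        omega
      · subst h
        rw [h1] at h5
        injection h5 with h5
        exact ih2 h5.symm
      · have := ih3 (run_src_lt h1 h5 h)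
        omega

/-- A strand which passes through sufficiently many copies of a diagram joins the `i`-th source to
the `i`-th sink. -/
theorem IsLayering.fixed_of_run_listPower {m q i i' : ℕ} {l : List Layer}
    (H : IsLayering n m l m) (hq : m ≤ q) (hi : i < m)
    (h : run n (BrownThompson.listPower l q) (src : ℕ → StrandTerm n) i = src i') :
    i' = i ∧ run n l (src : ℕ → StrandTerm n) i = src i := by
  have hi' := (H.listPower q).src_lt h hi
  obtain ⟨p, rfl⟩ : ∃ p, q = p + 1 := ⟨q - 1, by omega⟩
  have h0 := h
  rw [listPower_succ'] at h0
  obtain ⟨k, hk, -⟩ := run_append_eq_src h0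
  obtain ⟨h1, h2, h3⟩ := run_listPower_src hk h
  -- A drift would displace the strand by at least `q ≥ m` positions, but only `m` are available.
  rcases lt_trichotomy k i with hlt | rfl | hlt
  · have := h1 hlt
    omega
  · exact ⟨h2 rfl, hk⟩
  · have := h3 hlt
    omega

/-- Strands which pass through a diagram divide it into a left part and a right part. -/
theorem IsLayering.exists_liso_beside (hn : 0 < n) {l : List Layer} {h b c d y : ℕ} (hd : 0 < d)
    (H : IsLayering n h l (b + d + y))
    (hr : ∀ j < d, run n l (src : ℕ → StrandTerm n) (b + j) = src (c + j)) :
    ∃ l₁ l₂ z, h = c + d + z ∧ LIso n l (l₁ ++ l₂.map (Layer.shift (b + d))) ∧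
      IsLayering n c l₁ b ∧ IsLayering n z l₂ y := by
  induction l using List.reverseRecOn generalizing b y with
  | nil =>
    have h0 := hr 0 hd
    injection h0 with h0
    obtain rfl : b = c := by omega
    exact ⟨[], [], y, isLayering_nil_iff.1 H, .refl _, .nil _, .nil _⟩
  | append_singleton l u ih =>
    obtain ⟨v, e⟩ := u
    obtain ⟨mid, H1, H2⟩ := isLayering_append_iff.1 H
    obtain ⟨r, rfl, H3⟩ := isLayering_cons_iff.1 H2
    have H4 := isLayering_nil_iff.1 H3
    simp only [run_append, run_cons, run_nil] at hr
    rcases intervals_disjoint_or_meet b d e _ hd (v.outputs_pos hn) with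
      ⟨s, rfl⟩ | ⟨s, rfl⟩ | ⟨i, hi, j, hj, hij⟩
    · obtain ⟨l₁, l₂, z, h1, h2, h3, h4⟩ := ih (b := b) (y := s + v.inputs n + r)
        (by convert H1 using 1; omega) fun j hj => by
          rw [← hr j hj, step_left _ _ (by omega)]
      obtain rfl : y = s + v.outputs n + r := by omega
      refine ⟨l₁, l₂ ++ [⟨v, s⟩], z, h1, (h2.append_right _).trans (.of_eq ?_), h3,
        h4.append (.cons v s r (.nil _))⟩
      simp [Layer.shift]
    · obtain ⟨l₁, l₂, z, h1, h2, h3, h4⟩ := ih (b := e + v.inputs n + s) (y := y)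
        (by convert H1 using 1; omega) fun j hj => by
          rw [← hr j hj, add_assoc (e + v.outputs n) s j, step_right, add_assoc _ s j]
      refine ⟨l₁ ++ [⟨v, e⟩], l₂, z, h1, (h2.append_right _).trans ?_,
        h3.append (.cons v e s (.nil _)), h4⟩
      -- A last vertex on the left must still be drawn above the right part `l₂`.
      have := (LIso.interchange (IsLayering.cons (n := n) v e s (.nil _)) d l₂).symm.append_left l₁
      simpa only [List.append_assoc] using this
    · have h0 := hr i hi
      rw [hij, step_out _ _ _ hj] at h0
      exact absurd h0 (outLabel_ne_src _ _ _ _)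

end Substitution

/-! ## Strand diagrams of fractions -/

section Fractions

variable {n : ℕ}

/-- The layers of the reflected diagram. -/
def reflectLayers (l : List Layer) : List Layer := (l.map fun x => ⟨x.kind.flip, x.left⟩).reverse

theorem reflectLayers_append (l l' : List Layer) :
    reflectLayers (l ++ l') = reflectLayers l' ++ reflectLayers l := by
  simp [reflectLayers]

theorem reflectLayers_reflectLayers (l : List Layer) : reflectLayers (reflectLayers l) = l := by
  simp [reflectLayers, Function.comp_def, VertexKind.flip_flip]

theorem act_append_reflectLayers (hn : 0 < n) (l : List Layer) :
    act n (l ++ reflectLayers l) = id := by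
  induction l using List.reverseRecOn with
  | nil => rfl
  | append_singleton l u ih =>
    have h : l ++ [u] ++ reflectLayers (l ++ [u])
        = l ++ ([⟨u.kind, u.left⟩, ⟨u.kind.flip, u.left⟩] ++ reflectLayers l) := by
      rw [reflectLayers_append]
      simp [reflectLayers]
    rw [h, act_append, act_append, act_cancel hn, Function.comp_id, ← act_append, ih]

theorem act_reflectLayers_append (hn : 0 < n) (l : List Layer) :
    act n (reflectLayers l ++ l) = id := by
  have := act_append_reflectLayers hn (reflectLayers l)
  rwa [reflectLayers_reflectLayers] at this

theorem act_reflectLayers_congr (hn : 0 < n) {l l' : List Layer} (h : act n l = act n l') :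
    act n (reflectLayers l) = act n (reflectLayers l') := by
  have h1 := act_append_reflectLayers hn l
  have h2 := act_reflectLayers_append hn l'
  rw [act_append] at h1 h2
  calc act n (reflectLayers l)
      = act n (reflectLayers l) ∘ (act n l' ∘ act n (reflectLayers l')) := by
        rw [h2, Function.comp_id]
    _ = act n (reflectLayers l') := by rw [← h, ← Function.comp_assoc, h1, Function.id_comp]

/-- The layers of the first `k` trees of a forest, the root of the first one being at
position `a`. -/
def forestLayers (p : ℕ → NTree n) : ℕ → ℕ → List Layer
  | 0, _ => []
  | k + 1, a => (p k).layers (a + k) ++ forestLayers p k a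

theorem forestLayers_congr {p q : ℕ → NTree n} {k : ℕ} (h : ∀ i < k, p i = q i) (a : ℕ) :
    forestLayers p k a = forestLayers q k a := by
  induction k with
  | zero => rfl
  | succ k ih =>
    rw [forestLayers, forestLayers, h k (Nat.lt_succ_self k), ih fun i hi => h i (by omega)]

theorem forestLayers_add (p : ℕ → NTree n) (k m a : ℕ) :
    forestLayers p (k + m) a
      = forestLayers (fun i => p (k + i)) m (a + k) ++ forestLayers p k a := by
  induction m with
  | zero => rfl
  | succ m ih => rw [← add_assoc, forestLayers, forestLayers, ih, add_assoc, List.append_assoc]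

theorem flatMap_finRange_reverse {α : Type} (g G : ℕ → List α) (h0 : G 0 = [])
    (hG : ∀ k, G (k + 1) = g k ++ G k) (m : ℕ) :
    ((List.finRange m).reverse.flatMap fun j : Fin m => g j) = G m := by
  induction m with
  | zero => simp [h0]
  | succ m ih =>
    rw [List.finRange_succ_last, List.reverse_append, List.flatMap_append, hG, ← ih,
      ← List.map_reverse, List.flatMap_map]
    simp

/-- The forest of the children of a vertex. -/
def childForest (c : Fin n → NTree n) (i : ℕ) : NTree n := if h : i < n then c ⟨i, h⟩ else .leaf

theorem NTree.layers_node (c : Fin n → NTree n) (a : ℕ) :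
    (NTree.node c).layers a = ⟨.split, a⟩ :: forestLayers (childForest c) n a := by
  rw [NTree.layers]
  congr 1
  rw [← flatMap_finRange_reverse (fun k => (childForest c k).layers (a + k))
    (fun k => forestLayers (childForest c) k a) rfl (fun _ => rfl) n]
  congr 1
  funext j
  simp [childForest]

theorem forestLayers_shift {p : ℕ → NTree n} {k : ℕ}
    (h : ∀ i < k, ∀ x a, (p i).layers (x + a) = ((p i).layers a).map (Layer.shift x)) (x a : ℕ) :
    forestLayers p k (x + a) = (forestLayers p k a).map (Layer.shift x) := by
  induction k with
  | zero => rfl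
  | succ k ih =>
    rw [forestLayers, forestLayers, add_assoc, h k (Nat.lt_succ_self k),
      ih fun i hi => h i (by omega), List.map_append]

theorem NTree.layers_shift (t : NTree n) (x a : ℕ) :
    t.layers (x + a) = (t.layers a).map (Layer.shift x) := by
  induction t generalizing x a with
  | leaf => rfl
  | node c ih =>
    rw [NTree.layers_node, NTree.layers_node, List.map_cons, forestLayers_shift]
    · rfl
    · intro i hi x a
      simp only [childForest, hi, dif_pos]
      exact ih _ x a

theorem isLayering_forestLayers (p : ℕ → NTree n) (k a b : ℕ) :
    IsLayering n (a + k + b) (forestLayers p k a)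
      (a + (∑ i ∈ Finset.range k, (p i).leaves) + b) := by
  induction k generalizing b with
  | zero => exact .nil _
  | succ k ih =>
    rw [forestLayers, Finset.sum_range_succ]
    have h1 := (p k).isLayering (a + k) b
    have h2 := ih ((p k).leaves + b)
    rw [show a + (k + 1) + b = a + k + 1 + b by omega]
    refine h1.append ?_
    convert h2 using 1 <;> omega

/-- Grafting tree by tree interleaves the layers of `p` and `q`; interchanging side-by-side parts
brings all of `p` above all of `q`. -/
theorem liso_forestLayers_stack {p q : ℕ → NTree n} {k : ℕ}
    (h : ∀ i < k, ∀ r a, LIso n (((p i).graft r).layers a)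
      ((p i).layers a ++ forestLayers r (p i).leaves a)) (a : ℕ) :
    LIso n (forestLayers (NTree.stack p q) k a)
      (forestLayers p k a ++ forestLayers q (∑ i ∈ Finset.range k, (p i).leaves) a) := by
  induction k with
  | zero => exact .refl _
  | succ k ih =>
    rw [forestLayers, forestLayers, Finset.sum_range_succ, forestLayers_add]
    refine ((h k (Nat.lt_succ_self k) _ _).append (ih fun i hi => h i (by omega))).trans ?_
    set S := ∑ i ∈ Finset.range k, (p i).leaves
    have hi := LIso.interchange (isLayering_forestLayers p k a 0) 0
      (forestLayers (fun x => q (S + x)) (p k).leaves 0)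
    simp only [← forestLayers_shift (fun _ _ => NTree.layers_shift _), add_zero] at hi
    have := hi.symm.context ((p k).layers (a + k)) (forestLayers q S a)
    simpa only [List.append_assoc] using this

theorem NTree.liso_layers_graft (t : NTree n) (p : ℕ → NTree n) (a : ℕ) :
    LIso n ((t.graft p).layers a) (t.layers a ++ forestLayers p t.leaves a) := by
  induction t generalizing p a with
  | leaf => exact .of_eq (by simp [NTree.graft, NTree.layers, NTree.leaves, forestLayers])
  | node c ih =>
    have hpre : ∀ j ≤ n, NTree.pre (fun l => (c l).leaves) j
        = ∑ i ∈ Finset.range j, (childForest c i).leaves := by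
      intro j hj
      refine Finset.sum_congr rfl fun l hl => ?_
      have : l < n := by
        have := Finset.mem_range.1 hl
        omega
      simp [childForest, this]
    have hstack : forestLayers (childForest fun j => (c j).graft fun i =>
          p (NTree.pre (fun l => (c l).leaves) j + i)) n a
        = forestLayers (NTree.stack (childForest c) p) n a := by
      refine forestLayers_congr (fun i hi => ?_) a
      rw [childForest, dif_pos hi]
      simp only [hpre i hi.le, NTree.stack]
      rw [childForest, dif_pos hi]
    rw [NTree.graft_node, NTree.layers_node, hstack, NTree.layers_node, NTree.leaves_node,
      hpre n le_rfl]
    refine (liso_forestLayers_stack (fun i hi r a => ?_) a).append_left [⟨.split, a⟩]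
    rw [childForest, dif_pos hi]
    exact ih _ r a

theorem TreePair.layers_diagram (x : TreePair n) :
    x.diagram.layers = x.num.layers 0 ++ reflectLayers (x.den.layers 0) := rfl

/-- The forest added to the numerator meets its own reflection, added to the denominator, and
cancels. -/
theorem TreePair.act_expand (hn : 0 < n) (x : TreePair n) (p : ℕ → NTree n) :
    act n (x.expand p).diagram.layers = act n x.diagram.layers := by
  have h1 := (x.num.liso_layers_graft p 0).act_eq
  have h2 := act_reflectLayers_congr hn (x.den.liso_layers_graft p 0).act_eq
  rw [TreePair.layers_diagram, TreePair.layers_diagram, act_append]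
  change act n (reflectLayers ((x.den.graft p).layers 0)) ∘ act n ((x.num.graft p).layers 0) = _
  rw [h1, h2, reflectLayers_append, ← act_append, x.same, List.append_assoc,
    ← List.append_assoc (forestLayers p _ 0), act_append, act_append, act_append_reflectLayers hn,
    Function.comp_id, ← act_append]

theorem TreePair.act_eq (hn : 0 < n) {x y : TreePair n} (h : ThompsonF.mk x = ThompsonF.mk y) :
    act n x.diagram.layers = act n y.diagram.layers := by
  obtain ⟨p, q, h1, h2⟩ := ThompsonF.mk_eq_mk.1 h
  have : x.expand p = y.expand q := by
    simp only [TreePair.expand, h1, h2]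
  rw [← x.act_expand hn p, this, y.act_expand hn q]

theorem TreePair.act_glue (hn : 0 < n) {x y : TreePair n} (h : x.den = y.num) :
    act n (TreePair.glue x y h).diagram.layers = act n (x.diagram.layers ++ y.diagram.layers) := by
  rw [TreePair.layers_diagram, TreePair.layers_diagram, TreePair.layers_diagram, ← h]
  change act n (x.num.layers 0 ++ reflectLayers (y.den.layers 0)) = _
  rw [List.append_assoc, ← List.append_assoc (reflectLayers _), act_append, act_append, act_append,
    act_reflectLayers_append hn, Function.comp_id]

/-! ### Diagrams representing products and powers in `F_n`. -/

namespace StrandDiagram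

theorem represents_mk_iff (hn : 0 < n) {D : StrandDiagram n 1 1} {x : TreePair n} :
    D.Represents (ThompsonF.mk x) ↔ act n D.layers = act n x.diagram.layers := by
  constructor
  · rintro ⟨y, hy, h⟩
    exact ((equivalent_iff hn).1 h).trans (TreePair.act_eq hn hy)
  · exact fun h => ⟨x, rfl, (equivalent_iff hn).2 h⟩

theorem Represents.congr (hn : 0 < n) {D D' : StrandDiagram n 1 1} {g : ThompsonF n}
    (hD : D.Represents g) (h : act n D'.layers = act n D.layers) : D'.Represents g := by
  obtain ⟨x, rfl⟩ := ThompsonF.exists_rep g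
  rw [represents_mk_iff hn] at hD ⊢
  exact h.trans hD

theorem Represents.mul (hn : 0 < n) {D D' : StrandDiagram n 1 1} {g g' : ThompsonF n}
    (hD : D.Represents g) (hD' : D'.Represents g') : (D.comp D').Represents (g * g') := by
  obtain ⟨x, y, rfl, rfl, h⟩ := ThompsonF.exists_rep₂ g g'
  rw [represents_mk_iff hn] at hD hD'
  rw [ThompsonF.mk_mul_mk x y h, represents_mk_iff hn, TreePair.act_glue hn h]
  change act n (_ ++ _) = _
  rw [act_append, act_append, hD, hD']

theorem exists_represents (g : ThompsonF n) : ∃ D : StrandDiagram n 1 1, D.Represents g := by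
  obtain ⟨x, rfl⟩ := ThompsonF.exists_rep g
  exact ⟨x.diagram, x, rfl, Relation.EqvGen.refl _⟩

theorem represents_one (hn : 0 < n) {D : StrandDiagram n 1 1} (h : act n D.layers = id) :
    D.Represents 1 := by
  change D.Represents (ThompsonF.mk ⟨.leaf, .leaf, rfl⟩)
  rw [represents_mk_iff hn, h]
  rfl

theorem layers_comp {h k m : ℕ} (A : StrandDiagram n h k) (B : StrandDiagram n k m) :
    (A.comp B).layers = A.layers ++ B.layers := rfl

theorem layers_reflect {h k : ℕ} (A : StrandDiagram n h k) :
    A.reflect.layers = reflectLayers A.layers := rfl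

theorem layers_beside {h k h' k' : ℕ} (A : StrandDiagram n h k) (B : StrandDiagram n h' k') :
    (A.beside B).layers = A.layers ++ B.layers.map (Layer.shift k) := rfl

/-- If `S E S⁻¹` represents `g`, then `S Eᵖ S⁻¹` represents `gᵖ`. -/
theorem Represents.power (hn : 0 < n) {m : ℕ} {g : ThompsonF n} {S : StrandDiagram n 1 m}
    {E : StrandDiagram n m m} (h : ((S.comp E).comp S.reflect).Represents g) (p : ℕ) :
    ((S.comp (E.power p)).comp S.reflect).Represents (g ^ p) := by
  induction p with
  | zero =>
    rw [pow_zero]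
    refine represents_one hn ?_
    have : ((S.comp (E.power 0)).comp S.reflect).layers = S.layers ++ reflectLayers S.layers := by
      simp [layers_comp, layers_reflect, layers_power, listPower_zero]
    rw [this, act_append_reflectLayers hn]
  | succ p ih =>
    rw [pow_succ]
    refine (ih.mul hn h).congr hn ?_
    simp only [layers_comp, layers_reflect, layers_power, listPower_succ']
    have h1 := act_reflectLayers_append hn S.layers
    simp only [act_append, ← Function.comp_assoc] at h1 ⊢
    rw [Function.comp_assoc _ (act n S.layers), h1, Function.comp_id]

end StrandDiagram

end Fractions

open StrandTerm StrandDiagram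

variable {n : ℕ}

/-! ## Existence of essential decompositions -/

theorem IsOutput.bind {v : VertexKind} {a : ℕ} {g : ℕ → StrandTerm n} (h : IsOutput v a g)
    (f : ℕ → StrandTerm n) : IsOutput v a fun i => (g i).bind f := by
  obtain ⟨x, hx⟩ := h
  refine ⟨fun i => (x i).bind f, fun j hj => ?_⟩
  simp only [hx j hj, (isStrandHom_bind f).outLabel]
  rfl

/-- Adding a diagram on top substitutes into the labels, which preserves every redex of the lower
part. -/
theorem NoRedex.of_append_right {l l' : List Layer}
    (h : NoRedex (l ++ l') (src : ℕ → StrandTerm n)) : NoRedex l' (src : ℕ → StrandTerm n) := by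
  by_contra hr
  obtain ⟨P, v, a, R, rfl, -, hout⟩ := exists_redex hr
  rw [← List.append_assoc, ← List.append_assoc, noRedex_append, noRedex_append] at h
  refine h.1.2.1 ?_
  have : run n (l ++ P) src = fun i => (run n P src i).bind (run n l (src : ℕ → StrandTerm n)) := by
    funext i
    rw [run_append, run_eq_bind P]
  rw [this]
  exact hout.bind _

theorem NoRedex.of_append_left {l l' : List Layer} {f : ℕ → StrandTerm n}
    (h : NoRedex (l ++ l') f) : NoRedex l f := (noRedex_append.1 h).1

theorem listPower_append_comm (a b : List Layer) (p : ℕ) :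
    listPower (a ++ b) p ++ a = a ++ listPower (b ++ a) p := by
  induction p with
  | zero => simp [listPower_zero]
  | succ p ih =>
    rw [listPower_succ, listPower_succ, List.append_assoc, ih]
    simp only [List.append_assoc]

theorem VertexKind.flip_ne (v : VertexKind) : v.flip ≠ v := by
  cases v <;> simp [VertexKind.flip]

theorem not_isOutput_flip_step (hn : 0 < n) (w : VertexKind) (c c' : ℕ) :
    ¬ IsOutput w.flip c' (step n ⟨w, c⟩ (src : ℕ → StrandTerm n)) := by
  intro h
  rcases isOutput_step_cases hn h with ⟨h, -⟩ | ⟨d, -, h⟩ | ⟨d, -, h⟩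
  · exact w.flip_ne h
  · exact not_isOutput_src hn _ _ h
  · exact not_isOutput_src hn _ _ h

/-- If a diagram is conjugate to `E` and is not larger than any other conjugate, then its powers are
reduced. -/
theorem noRedex_listPower_of_minimal (hn : 0 < n) {g : ThompsonF n} {L : ℕ}
    (hL : ∀ (m : ℕ) (S : StrandDiagram n 1 m) (E : StrandDiagram n m m),
      ((S.comp E).comp S.reflect).Represents g → L ≤ E.layers.length) (p : ℕ) :
    ∀ (m : ℕ) (S : StrandDiagram n 1 m) (E : StrandDiagram n m m),
      ((S.comp E).comp S.reflect).Represents g → E.layers.length = L →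
        NoRedex (listPower E.layers p) (src : ℕ → StrandTerm n) := by
  have hone : ∀ (m : ℕ) (S : StrandDiagram n 1 m) (E : StrandDiagram n m m),
      ((S.comp E).comp S.reflect).Represents g → E.layers.length = L →
        NoRedex E.layers (src : ℕ → StrandTerm n) := by
    intro m S E hE hl
    refine (isReduced_iff_noRedex hn).1 ((isReduced_iff_le hn).2 fun D' hD' => ?_)
    rw [hl]
    refine hL m S D' (hE.congr hn ?_)
    simp only [layers_comp, act_append, hD']
  induction p with
  | zero => exact fun _ _ _ _ _ => trivial
  | succ p ih =>
    intro m S E hE hl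
    by_cases hp : p = 0
    · subst hp
      rw [listPower_one]
      exact hone m S E hE hl
    obtain ⟨p, rfl⟩ : ∃ k, p = k + 1 := ⟨p - 1, by omega⟩
    by_contra hr
    have hX := ih m S E hE hl
    have hE1 := hone m S E hE hl
    rw [listPower_succ', noRedex_append] at hr
    -- The first redex lies in the last copy `E = Q w R`. As `E` alone is reduced, `w` is fed by
    -- strands crossing `Q` and moves to the top: `E = w F`.
    obtain ⟨Q, w, b, R, hQ, -, hout⟩ := exists_redex fun h => hr ⟨hX, h⟩
    rw [hQ, noRedex_append, noRedex_append] at hE1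
    rw [← run_append] at hout
    obtain ⟨c, Q', hiso, hc⟩ := exists_liso_cons hn (exists_src_of_isOutput hn hE1.1.2.1 hout)
    have hcX := isOutput_of_run_eq hout (by rwa [VertexKind.outputs_flip])
    have hEiso : LIso n E.layers ([⟨w, c⟩] ++ (Q' ++ R)) := by
      rw [hQ, ← List.append_assoc]
      exact hiso.append_right R
    obtain ⟨m', H1, H2⟩ := isLayering_append_iff.1 (hEiso.isLayering_iff.1 E.isLayering)
    set F := Q' ++ R
    -- The rotated diagram `F w`, with `w` absorbed into `S`, is again a minimal conjugate, so its
    -- power `p + 1` has no redex.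
    have hF := ih m' (S.comp ⟨_, H1⟩) ⟨F ++ [⟨w, c⟩], H2.append H1⟩ (hE.congr hn (by
      simp only [layers_comp, layers_reflect, reflectLayers_append, act_append, hEiso.act_eq]
      have h1 := act_append_reflectLayers hn [⟨w, c⟩]
      rw [act_append] at h1
      simp only [← Function.comp_assoc]
      rw [Function.comp_assoc _ (act n (reflectLayers [⟨w, c⟩])), h1, Function.comp_id]))
      (by rw [← hl, hEiso.length_eq]; simp)
    simp only [listPower_succ', ← List.append_assoc] at hF
    have hZ : LIso n (listPower E.layers (p + 1))
        ([⟨w, c⟩] ++ (listPower (F ++ [⟨w, c⟩]) p ++ F)) := by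
      refine (hEiso.listPower _).trans (.of_eq ?_)
      rw [listPower_succ', ← List.append_assoc, listPower_append_comm, List.append_assoc]
    rw [hZ.run_eq] at hcX
    rw [noRedex_append] at hF
    -- Here `E^(p+1) = w (F w)^p F`, and a `w` placed below does not cancel with `(F w)^p F`. Its
    -- partner would have to be the leading `w`, which has the wrong kind.
    obtain ⟨c', -, -, hc'⟩ := exists_liso_cons hn (exists_src_of_isOutput hn hF.2.1 hcX)
    exact not_isOutput_flip_step hn w c c'
      (isOutput_of_run_eq hcX (by rwa [VertexKind.outputs_flip]))

theorem exists_isEssentialDecomposition (hn : 0 < n) (g : ThompsonF n) :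
    ∃ (m : ℕ) (S : StrandDiagram n 1 m) (E : StrandDiagram n m m),
      IsEssentialDecomposition g S E := by
  classical
  have hex : ∃ L, ∃ (m : ℕ) (S : StrandDiagram n 1 m) (E : StrandDiagram n m m),
      ((S.comp E).comp S.reflect).Represents g ∧ E.layers.length = L := by
    obtain ⟨D, hD⟩ := exists_represents g
    refine ⟨_, 1, strands n 1, D, hD.congr hn ?_, rfl⟩
    simp [layers_comp, layers_reflect, strands, reflectLayers]
  obtain ⟨m, S, E, hE, hl⟩ := Nat.find_spec hex
  refine ⟨m, S, E, hE, fun p => ?_⟩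
  rw [isReduced_iff_noRedex hn, layers_power]
  exact noRedex_listPower_of_minimal hn
    (fun m S E h => Nat.find_min' hex ⟨m, S, E, h, rfl⟩) p m S E hE hl

/-! ## Stabilization -/

theorem StrandDiagram.IsReduced.reflect (hn : 0 < n) {h k : ℕ} {D : StrandDiagram n h k} (hD : D.IsReduced) :
    D.reflect.IsReduced := by
  rw [isReduced_iff_le hn] at hD ⊢
  intro D' hD'
  have := hD D'.reflect (by
    rw [layers_reflect, act_reflectLayers_congr hn hD', layers_reflect,
      reflectLayers_reflectLayers])
  simpa [layers_reflect, reflectLayers] using this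

theorem reflectLayers_listPower (l : List Layer) (p : ℕ) :
    reflectLayers (listPower l p) = listPower (reflectLayers l) p := by
  induction p with
  | zero => rfl
  | succ p ih => rw [listPower_succ, reflectLayers_append, ih, listPower_succ']

/-- After multiplication by a power of `E`, no further cancellation with powers of `E` occurs. -/
theorem exists_stable_right (hn : 0 < n) {h m : ℕ} (A : StrandDiagram n h m)
    (E : StrandDiagram n m m) (hE : ∀ p, (E.power p).IsReduced) :
    ∃ (K : ℕ) (A' : StrandDiagram n h m),
      act n A'.layers = act n (A.layers ++ listPower E.layers K) ∧
        ∀ q, (A'.comp (E.power q)).IsReduced := by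
  choose D hD1 hD2 _ using fun q => exists_equivalent_isReduced (A.comp (E.power q))
  have hact : ∀ q, act n (D q).layers = act n (A.layers ++ listPower E.layers q) := fun q => by
    rw [← (hD1 q).act_eq hn, layers_comp, layers_power]
  -- `A⁻¹ D_q` is equivalent to the reduced, hence shortest, diagram `E^q`.
  have hbound : ∀ q, q * E.layers.length ≤ A.layers.length + (D q).layers.length := by
    intro q
    have h1 := (isReduced_iff_le hn).1 (hE q) (A.reflect.comp (D q)) (by
      have h2 := act_reflectLayers_append hn A.layers
      rw [act_append] at h2
      rw [layers_comp, layers_reflect, act_append, hact, act_append, Function.comp_assoc, h2,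
        Function.comp_id, layers_power])
    simpa [layers_power, length_listPower, layers_comp, layers_reflect, reflectLayers] using h1
  -- By `hbound` these subtractions are not truncated. Minimality at `K` gives `|D_(K+q)| ≥ |D_K| +
  -- q|E|`, so `D_K E^q` is already as short as its reduced form.
  obtain ⟨K, hK⟩ : ∃ K, ∀ q, A.layers.length + (D K).layers.length - K * E.layers.length ≤
      A.layers.length + (D q).layers.length - q * E.layers.length :=
    ⟨Function.argmin fun q => A.layers.length + (D q).layers.length - q * E.layers.length,
      fun q => Function.argmin_le (fun q => A.layers.length + (D q).layers.length -
        q * E.layers.length) q⟩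
  refine ⟨K, D K, hact K, fun q => (isReduced_iff_le hn).2 fun D' hD' => ?_⟩
  have h1 := (isReduced_iff_le hn).1 (hD2 (K + q)) D' (by
    rw [hD', hact, layers_comp, act_append, hact, layers_power, listPower_add,
      ← List.append_assoc, ← act_append])
  have h2 := hK (K + q)
  have h3 := hbound (K + q)
  have h4 := hbound K
  rw [layers_comp, List.length_append, layers_power, length_listPower]
  rw [add_mul] at h2 h3
  omega

theorem exists_stable_left (hn : 0 < n) {h m : ℕ} (B : StrandDiagram n m h)
    (E : StrandDiagram n m m) (hE : ∀ p, (E.power p).IsReduced) :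
    ∃ (K : ℕ) (B' : StrandDiagram n m h),
      act n B'.layers = act n (listPower E.layers K ++ B.layers) ∧
        ∀ q, ((E.power q).comp B').IsReduced := by
  have hlay : ∀ p, (E.reflect.power p).layers = reflectLayers (listPower E.layers p) := fun p => by
    rw [layers_power, layers_reflect, reflectLayers_listPower]
  obtain ⟨K, A', h1, h2⟩ := exists_stable_right hn B.reflect E.reflect fun p => by
    have := IsReduced.reflect hn (hE p)
    rw [isReduced_iff_noRedex hn] at this ⊢
    rwa [hlay, ← layers_power]
  refine ⟨K, A'.reflect, ?_, fun q => ?_⟩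
  · rw [layers_reflect, act_reflectLayers_congr hn h1, reflectLayers_append, layers_reflect,
      layers_reflect, reflectLayers_reflectLayers, ← reflectLayers_listPower,
      reflectLayers_reflectLayers]
  · have := IsReduced.reflect hn (h2 q)
    rw [isReduced_iff_noRedex hn] at this ⊢
    rwa [layers_reflect, layers_comp, reflectLayers_append, hlay, reflectLayers_reflectLayers,
      ← layers_power] at this

/-! ## Cancellation across powers -/

/-- A vertex sitting on the parallel edges between `l₁` and `l₂` slides through all copies, and the
number of these edges changes as it passes. -/
theorem liso_cons_listPower (v : VertexKind) {c : ℕ} {l₁ : List Layer} (H : IsLayering n c l₁ c)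
    (l₂ : List Layer) (q : ℕ) :
    LIso n ([⟨v, c⟩] ++ listPower (l₁ ++ l₂.map (Layer.shift (c + v.outputs n))) q)
      (listPower (l₁ ++ l₂.map (Layer.shift (c + v.inputs n))) q ++ [⟨v, c⟩]) := by
  have hone : LIso n ([⟨v, c⟩] ++ (l₁ ++ l₂.map (Layer.shift (c + v.outputs n))))
      (l₁ ++ l₂.map (Layer.shift (c + v.inputs n)) ++ [⟨v, c⟩]) := by
    have h1 := (LIso.interchange H 0 [⟨v, 0⟩]).symm.append_right
      (l₂.map (Layer.shift (c + v.outputs n)))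
    have h2 := (LIso.interchange (IsLayering.cons (n := n) v c 0 (.nil _)) 0 l₂).append_left l₁
    simp only [List.map_cons, List.map_nil, Layer.shift, add_zero, List.append_assoc] at h1 h2 ⊢
    exact h1.trans h2
  induction q with
  | zero => exact .refl _
  | succ q ih =>
    rw [listPower_succ, listPower_succ, ← List.append_assoc]
    refine (hone.append_right _).trans ?_
    have := ih.append_left (l₁ ++ l₂.map (Layer.shift (c + v.inputs n)))
    simpa only [List.append_assoc] using this

theorem eqUpToParallelEdges_beside (w : VertexKind) {a b : ℕ} (A : StrandDiagram n a a)
    (B : StrandDiagram n b b) :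
    EqUpToParallelEdges ((A.beside (strands n (w.inputs n))).beside B)
      ((A.beside (strands n (w.outputs n))).beside B) := by
  cases w
  · exact .replace A B
  · exact .symm (.replace A B)

/-- If `A Eᵖ` and `Eᵖ B` are reduced for all `p`, then the cancellations in `A Eᵖ B` take place
along parallel edges of `E`. -/
theorem exists_reduced_sandwich (hn : 0 < n) (N : ℕ) : ∀ (m : ℕ) (E : StrandDiagram n m m)
    (A : StrandDiagram n 1 m) (B : StrandDiagram n m 1), A.layers.length = N →
    (∀ q, NoRedex (A.layers ++ listPower E.layers q) (src : ℕ → StrandTerm n)) →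
    (∀ q, NoRedex (listPower E.layers q ++ B.layers) (src : ℕ → StrandTerm n)) →
    ∃ (m' : ℕ) (E' : StrandDiagram n m' m') (A' : StrandDiagram n 1 m')
      (B' : StrandDiagram n m' 1), EqUpToParallelEdges E E' ∧
      (∃ q₀, ∀ q, q₀ ≤ q →
        NoRedex (A'.layers ++ listPower E'.layers q ++ B'.layers) (src : ℕ → StrandTerm n)) ∧
      ∀ q, act n (A'.layers ++ listPower E'.layers q ++ B'.layers)
        = act n (A.layers ++ listPower E.layers q ++ B.layers) := by
  induction N with
  | zero =>
    intro m E A B hA hAE hEB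
    refine ⟨m, E, A, B, .isotopic (Relation.EqvGen.refl _), ⟨0, fun q _ => ?_⟩, fun _ => rfl⟩
    rw [List.length_eq_zero_iff.1 hA]
    exact hEB q
  | succ N ih =>
    intro m E A B hA hAE hEB
    by_cases hall : ∀ q, m ≤ q →
        NoRedex (A.layers ++ listPower E.layers q ++ B.layers) (src : ℕ → StrandTerm n)
    · exact ⟨m, E, A, B, .isotopic (Relation.EqvGen.refl _), ⟨m, hall⟩, fun _ => rfl⟩
    push Not at hall
    -- Exponents from `m` on suffice: a redex at one such `q` already exposes fixed strands of `E`,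
    -- while its absence at all of them finishes the proof.
    obtain ⟨q, hq, hr⟩ := hall
    rw [noRedex_append] at hr
    obtain ⟨Q, w, b, R, hQ, -, hout⟩ := exists_redex fun h => hr ⟨hAE q, h⟩
    have hEB' := hEB q
    rw [hQ, ← List.append_assoc, ← List.append_assoc, noRedex_append, noRedex_append] at hEB'
    rw [← run_append, List.append_assoc] at hout
    have hsrc := exists_src_of_isOutput hn hEB'.1.2.1 hout
    obtain ⟨c, Q', hiso, hc⟩ := exists_liso_cons hn (Q := Q) (w := w) (b := b) fun j hj => by
      obtain ⟨i, hi⟩ := hsrc j hj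
      obtain ⟨k, hk, -⟩ := run_append_eq_src hi
      exact ⟨k, hk⟩
    have hBiso : LIso n B.layers ([⟨w, c⟩] ++ (Q' ++ R)) := by
      rw [hQ, ← List.append_assoc]
      exact hiso.append_right R
    obtain ⟨m', H1, HB⟩ := isLayering_append_iff.1 (hBiso.isLayering_iff.1 B.isLayering)
    obtain ⟨y, rfl, H2⟩ := isLayering_cons_iff.1 H1
    obtain rfl := isLayering_nil_iff.1 H2
    -- The inputs of `w` cross `q ≥ m` copies of `E`, so they run straight through each copy.
    have hfix : ∀ j < w.inputs n,
        run n (listPower E.layers q) (src : ℕ → StrandTerm n) (c + j) = src (c + j) ∧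
          run n E.layers (src : ℕ → StrandTerm n) (c + j) = src (c + j) := by
      intro j hj
      obtain ⟨i, hi⟩ := hsrc j hj
      obtain ⟨k, hk, hi⟩ := run_append_eq_src hi
      rw [hc j hj] at hk
      injection hk with hk
      subst hk
      obtain ⟨h1, h2⟩ := E.isLayering.fixed_of_run_listPower hq (by omega) hi
      exact ⟨h1 ▸ hi, h2⟩
    have hcA : IsOutput w.flip c (run n A.layers (src : ℕ → StrandTerm n)) := by
      refine isOutput_of_run_eq hout fun j hj => ?_
      rw [VertexKind.outputs_flip] at hj
      rw [run_append, run_eq_bind, hc j hj]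
      exact (hfix j hj).1
    obtain ⟨A₀, hAiso⟩ := exists_liso_append_of_isOutput hn hcA
    -- Now `A` ends with the partner of `w` and `B` begins with `w`, at the same position `c`.
    obtain ⟨m', HA, H3⟩ := isLayering_append_iff.1 (hAiso.isLayering_iff.1 A.isLayering)
    obtain ⟨y', rfl, H4⟩ := isLayering_cons_iff.1 H3
    have H5 := isLayering_nil_iff.1 H4
    rw [VertexKind.outputs_flip] at H5
    obtain rfl : y' = y := by omega
    rw [VertexKind.inputs_flip] at HA
    obtain ⟨l₁, l₂, z, hz, hEiso, HX, HY⟩ := E.isLayering.exists_liso_beside hn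
      (w.inputs_pos hn) fun j hj => (hfix j hj).2
    obtain rfl : z = y' := by omega
    set X : StrandDiagram n c c := ⟨l₁, HX⟩
    set Y : StrandDiagram n z z := ⟨l₂, HY⟩
    have hlay : ∀ d, ((X.beside (strands n d)).beside Y).layers
        = l₁ ++ l₂.map (Layer.shift (c + d)) := fun d => by
      simp [layers_beside, strands, X, Y]
    have hpow := fun p => hEiso.listPower p
    have hw : ∀ p, LIso n (listPower E.layers p ++ [⟨w, c⟩])
        ([⟨w, c⟩] ++ listPower (l₁ ++ l₂.map (Layer.shift (c + w.outputs n))) p) := fun p =>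
      ((hpow p).append_right _).trans (liso_cons_listPower w HX l₂ p).symm
    have hw' : ∀ p, LIso n ([⟨w.flip, c⟩] ++ listPower E.layers p)
        (listPower (l₁ ++ l₂.map (Layer.shift (c + w.outputs n))) p ++ [⟨w.flip, c⟩]) := fun p => by
      have := liso_cons_listPower w.flip HX l₂ p
      rw [VertexKind.outputs_flip, VertexKind.inputs_flip] at this
      exact ((hpow p).append_left _).trans this
    -- Drop both vertices and give `E` as many parallel edges as `w` has outputs. Sliding the
    -- dropped vertex through the powers exhibits the new one-sided products as a prefix and a
    -- suffix of the old, so they stay free of redexes.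
    obtain ⟨m', E', A', B', hE', hred, hact⟩ := ih _
      ((X.beside (strands n (w.outputs n))).beside Y) ⟨A₀, HA⟩ ⟨Q' ++ R, HB⟩
      (by have := hAiso.length_eq; simp at this; simp only; omega)
      (fun p => by
        have h1 := (hAiso.append_right (listPower E.layers p)).trans
          (.trans (.of_eq (List.append_assoc _ _ _)) ((hw' p).append_left A₀))
        have h2 := (h1.noRedex_iff _).1 (hAE p)
        rw [← List.append_assoc] at h2
        rw [hlay]
        exact h2.of_append_left)
      (fun p => by
        have h1 := (hBiso.append_left (listPower E.layers p)).trans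
          (.trans (.of_eq (List.append_assoc _ _ _).symm) ((hw p).append_right (Q' ++ R)))
        have h2 := (h1.noRedex_iff _).1 (hEB p)
        rw [List.append_assoc] at h2
        rw [hlay]
        exact h2.of_append_right)
    refine ⟨m', E', A', B', .trans (.trans (.isotopic ?_)
      (eqUpToParallelEdges_beside w X Y)) hE', hred, fun p => (hact p).trans ?_⟩
    · rw [isotopic_iff, hlay]
      exact hEiso
    · have h1 := ((hAiso.append_right (listPower E.layers p)).append hBiso).act_eq
      have h2 := ((hw p).context (A₀ ++ [⟨w.flip, c⟩]) (Q' ++ R)).act_eq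
      have h3 := act_cancel hn w.flip c
      rw [VertexKind.flip_flip, ← List.singleton_append, act_append] at h3
      simp only [List.append_assoc] at h1 h2
      simp only [List.append_assoc, hlay]
      rw [h1, h2]
      simp only [act_append, Function.comp_assoc]
      rw [← Function.comp_assoc (act n [⟨w, c⟩]) (act n [⟨w.flip, c⟩]), h3, Function.id_comp]

theorem exists_reduced_products (hn : 0 < n) {m : ℕ} {g : ThompsonF n} {S : StrandDiagram n 1 m}
    {E : StrandDiagram n m m} (hE : IsEssentialDecomposition g S E) (h h' : ThompsonF n) :
    ∃ (k m' : ℕ) (Splus : StrandDiagram n 1 m') (E' : StrandDiagram n m' m')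
      (Sminus : StrandDiagram n m' 1),
      E'.IsReduced ∧ StrandDiagram.EqUpToParallelEdges E E' ∧
      ∀ p : ℕ, k ≤ p →
        ((Splus.comp (E'.power (p - k + 1))).comp Sminus).IsReduced ∧
        ((Splus.comp (E'.power (p - k + 1))).comp Sminus).Represents (h * g ^ p * h') := by
  obtain ⟨H, hH⟩ := exists_represents h
  obtain ⟨H', hH'⟩ := exists_represents h'
  obtain ⟨K, A, hA, hAE⟩ := exists_stable_right hn (H.comp S) E hE.2
  obtain ⟨K', B, hB, hEB⟩ := exists_stable_left hn (S.reflect.comp H') E hE.2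
  obtain ⟨m', E', A', B', hpar, ⟨q₀, hred⟩, hact⟩ := exists_reduced_sandwich hn _ m E A B rfl
    (fun q => by
      have := (isReduced_iff_noRedex hn).1 (hAE q)
      rwa [layers_comp, layers_power] at this)
    (fun q => by
      have := (isReduced_iff_noRedex hn).1 (hEB q)
      rwa [layers_comp, layers_power] at this)
  -- Of the `p` copies of `E`, `K` and `K'` are absorbed by stabilization and `q₀` go into `Splus`;
  -- the extra `1` leaves the required `p - k + 1` copies.
  refine ⟨K + K' + q₀ + 1, m', A'.comp (E'.power q₀), E', B', ?_, hpar, fun p hp => ?_⟩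
  · rw [isReduced_iff_noRedex hn]
    have := (hred (q₀ + 1) (by omega)).of_append_left
    rw [listPower_succ'] at this
    exact this.of_append_right.of_append_right
  obtain ⟨r, rfl⟩ : ∃ r, p = K + (q₀ + (r + 1)) + K' := ⟨p - (K + K' + q₀ + 1), by omega⟩
  rw [show K + (q₀ + (r + 1)) + K' - (K + K' + q₀ + 1) + 1 = r + 1 by omega]
  have hlay : (((A'.comp (E'.power q₀)).comp (E'.power (r + 1))).comp B').layers
      = A'.layers ++ listPower E'.layers (q₀ + (r + 1)) ++ B'.layers := by
    simp only [layers_comp, layers_power, listPower_add, List.append_assoc]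
  constructor
  · rw [isReduced_iff_noRedex hn, hlay]
    exact hred _ (by omega)
  · refine ((hH.mul hn (hE.1.power hn _)).mul hn hH').congr hn ?_
    rw [hlay, hact]
    simp only [layers_comp, layers_power, listPower_add, act_append, hA, hB, Function.comp_assoc]

end BrownThompson

theorem theorem5p5 (n : ℕ) (hn : 2 ≤ n) (g : ThompsonF n) :
    (∃ (m : ℕ) (S : StrandDiagram n 1 m) (E : StrandDiagram n m m),
      IsEssentialDecomposition g S E) ∧
    ∀ (m : ℕ) (S : StrandDiagram n 1 m) (E : StrandDiagram n m m),
      IsEssentialDecomposition g S E →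
      ∀ h h' : ThompsonF n,
        ∃ (k m' : ℕ) (Splus : StrandDiagram n 1 m') (E' : StrandDiagram n m' m')
          (Sminus : StrandDiagram n m' 1),
          E'.IsReduced ∧ StrandDiagram.EqUpToParallelEdges E E' ∧
          ∀ p : ℕ, k ≤ p →
            ((Splus.comp (E'.power (p - k + 1))).comp Sminus).IsReduced ∧
            ((Splus.comp (E'.power (p - k + 1))).comp Sminus).Represents (h * g ^ p * h') :=
  ⟨exists_isEssentialDecomposition (by omega) g,
    fun _ _ _ hE h h' => exists_reduced_products (by omega) hE h h'⟩
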